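/- **Conventions.** All complexes are abstract simplicial complexes; the distance between two vertices is the number of edges of a shortest path in the $1$-skeleton. A *loop* in $X$ is a subcomplex isomorphic to a triangulation of the circle. A *filling diagram* for a loop $\gamma$ in $X$ is a simplicial map $f:D\to X$, where $D$ is a (finite) triangulated $2$-disc and $f$ maps $\partial D$ isomorphically onto $\gamma$; it is *minimal* if $D$ has the least possible number of triangles among all filling diagrams for $\gamma$. A *$k$-vertex* of $D$ is an interior vertex of $D$ with exactly $k$ neighbours. A flag, simply connected complex $X$ is *$(s,t)$-uniform* ($s,t\ge 4$) if for every loop $\gamma$ in $X$ and every minimal filling diagram $(D,f)$ for $\gamma$ the following holds: if $s=t$, every interior vertex of $D$ is a $t$-vertex; if $s\ne t$, every interior vertex of $D$ is an $s$-vertex or a $t$-vertex, all neighbours of an $s$-vertex are $t$-vertices or boundary vertices, and the neighbours of a $t$-vertex form a full cycle $(v_1,\dots,v_t)$ such that each $v_i$ with $i$ odd is a $t$-vertex or a boundary vertex and each $v_i$ with $i$ even is an $s$-vertex or a boundary vertex. For an interior vertex $v$ of such a disc $D$, the *sphere* $S_n$ of radius $n$ about $v$ is the set of edges of $D$ both of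 whose endpoints are at distance $n$ from $v$; its *length* $|S_n|$ is the number of these edges, and its *area* $A_n$ is the number of triangles of $D$ inside it, i.e. all of whose vertices are at distance at most $n$ from $v$. We consider the spheres that are not cut off by the boundary of $D$, i.e. such that all vertices at distance less than $n$ from $v$ are interior vertices of $D$. **Theorem.** Let $s,t\ge 6$ be integers with $t$ even and $(s,t)\ne(6,6)$, and put $T=t-4$, $S=s-4$. For the spheres in minimal filling diagrams of loops in $(s,t)$-uniform complexes, $$\lim_{n\to\infty}\frac{A_n}{|S_n|}=\sqrt{\frac{T+8+\sqrt{T^2+8ST}}{T-8+\sqrt{T^2+8ST}}},$$ and this limit can also be expressed as $$\lim_{n\to\infty}\frac{A_n}{|S_n|}=\sqrt{\frac{P+2}{P-2}},\qquad P=\frac{T+\sqrt{T^2+8ST}}{4}.$$ Here the limit means: for every $\varepsilon>0$ there is $N$, depending only on $s$, $t$ and $\varepsilon$, such that for all $n\ge N$, every $(s,t)$-uniform complex $X$, every loop $\gamma$ in $X$, every minimal filling diagram $(D,f)$ for $\gamma$ and every interior vertex $v$ of $D$ such that all vertices at distance less than $n$ from $v$ are interior, the ratio $A_n/|S_n|$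 differs from the stated value by less than $\varepsilon$. -/

import Mathlib

universe u

noncomputable section

namespace SimplicialDisc

/-! ### Simplicial complexes

A simplicial complex with vertex set `V` is Mathlib's `AbstractSimplicialComplex V`
(all singletons are faces); subcomplexes may omit vertices and are
`PreAbstractSimplicialComplex V`. -/

open scoped Classical in
/-- The `1`-skeleton. The metric on the vertices is `(skeleton X).dist`. -/
def skeleton {V : Type*} (X : AbstractSimplicialComplex V) : SimpleGraph V where
  Adj a b := a ≠ b ∧ ({a, b} : Finset V) ∈ X.faces
  symm := ⟨fun a b h => ⟨h.1.symm, by rw [Finset.pair_comm]; exact h.2⟩⟩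
  loopless := ⟨fun _ h => h.1 rfl⟩

/-- Flag: every nonempty finite set of pairwise adjacent vertices spans a simplex. -/
def IsFlag {V : Type*} (X : AbstractSimplicialComplex V) : Prop :=
  ∀ s : Finset V, s.Nonempty → (∀ a ∈ s, ∀ b ∈ s, a ≠ b → (skeleton X).Adj a b) → s ∈ X.faces

open scoped Classical in
/-- Homotopy of edge paths relative to their endpoints: the congruence generated by deleting a
backtrack `a, b, a` and by replacing two sides `a, b, c` of a `2`-simplex by the third one. -/
inductive Homotopic {V : Type*} (X : AbstractSimplicialComplex V) :
    {a b : V} → (skeleton X).Walk a b → (skeleton X).Walk a b → Prop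
  | refl {a b : V} (p : (skeleton X).Walk a b) : Homotopic X p p
  | symm {a b : V} {p q : (skeleton X).Walk a b} : Homotopic X p q → Homotopic X q p
  | trans {a b : V} {p q r : (skeleton X).Walk a b} :
      Homotopic X p q → Homotopic X q r → Homotopic X p r
  | cons {a b c : V} (h : (skeleton X).Adj a b) {p q : (skeleton X).Walk b c} :
      Homotopic X p q → Homotopic X (.cons h p) (.cons h q)
  | backtrack {a b c : V} (h : (skeleton X).Adj a b) (h' : (skeleton X).Adj b a)
      (p : (skeleton X).Walk a c) : Homotopic X (.cons h (.cons h' p)) p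
  | triangle {a b c d : V} (hab : (skeleton X).Adj a b) (hbc : (skeleton X).Adj b c)
      (hac : (skeleton X).Adj a c) (hface : ({a, b, c} : Finset V) ∈ X.faces)
      (p : (skeleton X).Walk c d) : Homotopic X (.cons hab (.cons hbc p)) (.cons hac p)

/-- Simply connected: nonempty, connected, and every closed edge path is null-homotopic
(the edge-path group is trivial). -/
structure IsSimplyConnected {V : Type*} (X : AbstractSimplicialComplex V) : Prop where
  connected : (skeleton X).Connected
  null_homotopic : ∀ (a : V) (p : (skeleton X).Walk a a), Homotopic X p .nil

/-! ### Triangulated discs -/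

/-- The `2`-simplices. -/
def triangles {W : Type*} (D : AbstractSimplicialComplex W) : Set (Finset W) :=
  {τ | τ ∈ D.faces ∧ τ.card = 3}

/-- The number of `2`-simplices. -/
def area {W : Type*} (D : AbstractSimplicialComplex W) : ℕ := (triangles D).ncard

open scoped Classical in
/-- The link of a vertex, as a graph on the neighbours of that vertex. (For a complex of dimension
at most `2` this is the whole link.) -/
def linkGraph {W : Type*} (D : AbstractSimplicialComplex W) (v : W) :
    SimpleGraph ((skeleton D).neighborSet v) where
  Adj a b := a ≠ b ∧ ({v, a.1, b.1} : Finset W) ∈ D.faces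
  symm := ⟨fun a b h => ⟨h.1.symm, by rw [Finset.pair_comm]; exact h.2⟩⟩
  loopless := ⟨fun _ h => h.1 rfl⟩

/-- A boundary edge is an edge that lies in exactly one triangle. -/
def IsBoundaryEdge {W : Type*} (D : AbstractSimplicialComplex W) (e : Finset W) : Prop :=
  e ∈ D.faces ∧ e.card = 2 ∧ ∃! τ, τ ∈ triangles D ∧ e ⊆ τ

/-- A boundary vertex is an endpoint of a boundary edge. -/
def IsBoundaryVertex {W : Type*} (D : AbstractSimplicialComplex W) (v : W) : Prop :=
  ∃ e, IsBoundaryEdge D e ∧ v ∈ e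

/-- An interior vertex is a vertex that is not on the boundary. -/
def IsInteriorVertex {W : Type*} (D : AbstractSimplicialComplex W) (v : W) : Prop :=
  ¬ IsBoundaryVertex D v

/-- The boundary `∂D`: the boundary edges and their endpoints. -/
def boundary {W : Type*} (D : AbstractSimplicialComplex W) : PreAbstractSimplicialComplex W where
  faces := {σ | σ.Nonempty ∧ ∃ e, IsBoundaryEdge D e ∧ σ ⊆ e}
  isRelLowerSet_faces := fun {_} h =>
    ⟨h.1, fun _ hts ht => ⟨ht, h.2.imp fun _ he => ⟨he.1, hts.trans he.2⟩⟩⟩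

/-- A triangulated `2`-disc: a finite triangulated surface (the link of each vertex is a circle or
an arc) that is simply connected and has nonempty boundary. By the classification of compact
surfaces the disc is the only such surface. -/
structure IsDisc {W : Type*} (D : AbstractSimplicialComplex W) : Prop where
  finite : Finite W
  card_le : ∀ σ ∈ D.faces, σ.card ≤ 3
  link : ∀ v : W,
    (∃ n : ℕ, 3 ≤ n ∧ Nonempty (linkGraph D v ≃g SimpleGraph.cycleGraph n)) ∨
    (∃ n : ℕ, 2 ≤ n ∧ Nonempty (linkGraph D v ≃g SimpleGraph.pathGraph n))
  simplyConnected : IsSimplyConnected D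
  boundary_nonempty : ∃ v, IsBoundaryVertex D v

/-! ### Loops and filling diagrams -/

open scoped Classical in
/-- A loop (cycle) in `X`: a subcomplex isomorphic to a triangulation of the circle, that is, with
distinct vertices `c 0, …, c (n - 1)`, `n ≥ 3`, and edges `{c i, c (i + 1)}`, indices mod `n`. -/
def IsLoop {V : Type*} (X : AbstractSimplicialComplex V) (γ : PreAbstractSimplicialComplex V) :
    Prop :=
  γ ≤ X.toPreAbstractSimplicialComplex ∧
    ∃ n : ℕ, 3 ≤ n ∧ ∃ c : ZMod n → V, Function.Injective c ∧
      ∀ σ : Finset V, σ ∈ γ.faces ↔ σ.Nonempty ∧ ∃ i : ZMod n, σ ⊆ {c i, c (i + 1)}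

open scoped Classical in
/-- A filling diagram `(D, f)` for `γ`: `D` is a triangulated disc, `f` is a simplicial map, and
`f` maps `∂D` isomorphically onto `γ`. -/
structure IsFillingDiagram {V W : Type*} (X : AbstractSimplicialComplex V)
    (γ : PreAbstractSimplicialComplex V) (D : AbstractSimplicialComplex W) (f : W → V) :
    Prop where
  disc : IsDisc D
  simplicial : ∀ σ ∈ D.faces, σ.image f ∈ X.faces
  boundary_injOn : Set.InjOn f {v | IsBoundaryVertex D v}
  boundary_map : (boundary D).map f = γ

/-- A minimal filling diagram: no filling diagram for `γ` has fewer triangles. Discs are finite, so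
it is enough to let their vertex sets range over `Type`. -/
structure IsMinimalFillingDiagram {V : Type*} {W : Type} (X : AbstractSimplicialComplex V)
    (γ : PreAbstractSimplicialComplex V) (D : AbstractSimplicialComplex W) (f : W → V) :
    Prop where
  filling : IsFillingDiagram X γ D f
  minimal : ∀ (W' : Type) (D' : AbstractSimplicialComplex W') (f' : W' → V),
    IsFillingDiagram X γ D' f' → area D ≤ area D'

/-! ### `(s,t)`-uniform complexes -/

/-- A `k`-vertex of a disc: an interior vertex with exactly `k` neighbours. -/
def IsKVertex {W : Type*} (D : AbstractSimplicialComplex W) (k : ℕ) (v : W) : Prop :=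
  IsInteriorVertex D v ∧ ((skeleton D).neighborSet v).ncard = k

/-- The neighbours of `v` form a full cycle `(v₁, …, vₜ)` in `D` such that the `vᵢ` with `i` odd
are `t`-vertices or boundary vertices and the `vᵢ` with `i` even are `s`-vertices or boundary
vertices. Here `vᵢ` is `c (i - 1)`. -/
def HasAlternatingNeighbours {W : Type*} (D : AbstractSimplicialComplex W) (s t : ℕ) (v : W) :
    Prop :=
  ∃ c : Fin t → W, Function.Injective c ∧ Set.range c = (skeleton D).neighborSet v ∧
    (∀ i j, (skeleton D).Adj (c i) (c j) ↔ (SimpleGraph.cycleGraph t).Adj i j) ∧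
    (∀ i : Fin t, Odd (i.val + 1) → IsKVertex D t (c i) ∨ IsBoundaryVertex D (c i)) ∧
    (∀ i : Fin t, Even (i.val + 1) → IsKVertex D s (c i) ∨ IsBoundaryVertex D (c i))

/-- The condition that `(s,t)`-uniformity puts on the disc of a minimal filling diagram. -/
def IsUniformDisc {W : Type*} (D : AbstractSimplicialComplex W) (s t : ℕ) : Prop :=
  (s = t → ∀ v, IsInteriorVertex D v → IsKVertex D t v) ∧
  (s ≠ t → ∀ v, IsInteriorVertex D v →
    (IsKVertex D s v ∨ IsKVertex D t v) ∧
    (IsKVertex D s v → ∀ w, (skeleton D).Adj v w → IsKVertex D t w ∨ IsBoundaryVertex D w) ∧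
    (IsKVertex D t v → HasAlternatingNeighbours D s t v))

/-- `(s,t)`-uniform complexes, `s, t ≥ 4`. -/
structure IsUniform {V : Type*} (X : AbstractSimplicialComplex V) (s t : ℕ) : Prop where
  four_le_left : 4 ≤ s
  four_le_right : 4 ≤ t
  flag : IsFlag X
  simplyConnected : IsSimplyConnected X
  uniform : ∀ γ : PreAbstractSimplicialComplex V, IsLoop X γ →
    ∀ (W : Type) (D : AbstractSimplicialComplex W) (f : W → V),
      IsMinimalFillingDiagram X γ D f → IsUniformDisc D s t

/-! ### Spheres -/

/-- The sphere of radius `n` about `v`: the edges spanned by the vertices at distance `n`. -/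
def sphere {W : Type*} (D : AbstractSimplicialComplex W) (v : W) (n : ℕ) : Set (Finset W) :=
  {e | e ∈ D.faces ∧ e.card = 2 ∧ ∀ w ∈ e, (skeleton D).dist v w = n}

/-- The length of a sphere: its number of edges. -/
def sphereLength {W : Type*} (D : AbstractSimplicialComplex W) (v : W) (n : ℕ) : ℕ :=
  (sphere D v n).ncard

/-- The area of a sphere: the number of triangles inside it, all of whose vertices are at distance
at most `n` from the centre. -/
def sphereArea {W : Type*} (D : AbstractSimplicialComplex W) (v : W) (n : ℕ) : ℕ :=
  {τ | τ ∈ triangles D ∧ ∀ w ∈ τ, (skeleton D).dist v w ≤ n}.ncard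

/-- `lim Aₙ / |Sₙ| = L` for the spheres in minimal filling diagrams of loops in `(s,t)`-uniform
complexes. A disc is finite, so for each `n` one takes all the discs and all the centres `v` for
which the sphere of radius `n` about `v` is not cut off by the boundary of the disc (all vertices at
distance less than `n` from `v` are interior); the limit is uniform in all of these. -/
def SphereRatioTendsto (s t : ℕ) (L : ℝ) : Prop :=
  ∀ ε : ℝ, 0 < ε → ∃ N : ℕ, ∀ n : ℕ, N ≤ n →
    ∀ (V : Type u) (X : AbstractSimplicialComplex V), IsUniform X s t →
    ∀ γ : PreAbstractSimplicialComplex V, IsLoop X γ →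
    ∀ (W : Type) (D : AbstractSimplicialComplex W) (f : W → V), IsMinimalFillingDiagram X γ D f →
    ∀ v : W, IsInteriorVertex D v →
      (∀ w : W, (skeleton D).dist v w < n → IsInteriorVertex D w) →
      |(sphereArea D v n : ℝ) / (sphereLength D v n : ℝ) - L| < ε

end SimplicialDisc

end

/-!
Discrete Gauss–Bonnet for a disc whose interior vertices have degree at least six shows that
geodesics in it behave as in a space of nonpositive curvature: the triangles at a vertex `x` of the
`n`-th sphere about `v` meet the ball of radius `n - 1` in a single vertex or a single edge, and the
`n`-th sphere is a cycle. Every triangle between two consecutive spheres therefore has an edge on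
exactly one of them, so the layer between the spheres of radius `k` and `k + 1` has
`|S_k| + |S_{k+1}|` triangles, and counting the triangles at the vertices of the `k`-th sphere
expresses their total degree through `|S_{k-1}|`, `|S_k|` and `|S_{k+1}|`. Weighting the count by
the indicator function of the `s`-vertices gives a second relation. Together they form a linear
recurrence for the length `x` of a sphere and its number `y` of `s`-vertices, and for each root `q`
of `2 q ^ 2 = T q + S T` the linear form `φ = (s - 4) y + q (x - y)` satisfies
`φ (k + 2) = q φ (k + 1) - φ k`. The positive root `q = P` dominates, so `|S_n|` grows like `l ^ n`
with `l + l⁻¹ = P`, and `A_n / |S_n| = (∑ k < n, (|S_k| + |S_{k+1}|)) / |S_n|` tends to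
`(l + 1) / (l - 1) = √((P + 2) / (P - 2))`.
-/

noncomputable section

namespace SimplicialDisc

open Finset

open scoped Classical

section Local

variable {W : Type*} {D : AbstractSimplicialComplex W}

lemma mem_faces_of_subset {σ τ : Finset W} (hτ : τ ∈ D.faces) (h : σ ⊆ τ) (hσ : σ.Nonempty) :
    σ ∈ D.faces :=
  (D.isRelLowerSet_faces hτ).2 h hσ

lemma adj_of_mem_face {τ : Finset W} (hτ : τ ∈ D.faces) {a b : W} (ha : a ∈ τ) (hb : b ∈ τ)
    (hab : a ≠ b) : (skeleton D).Adj a b :=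
  ⟨hab, mem_faces_of_subset hτ (by simp [insert_subset_iff, ha, hb]) (by simp)⟩

lemma exists_eq_triple {τ : Finset W} (hτ : #τ = 3) {x y : W} (hx : x ∈ τ) (hy : y ∈ τ)
    (hxy : x ≠ y) : ∃ z, x ≠ z ∧ y ≠ z ∧ τ = {x, y, z} := by
  obtain ⟨z, hz⟩ : ∃ z, (τ.erase x).erase y = {z} := by
    rw [← card_eq_one, card_erase_of_mem (mem_erase.2 ⟨hxy.symm, hy⟩), card_erase_of_mem hx, hτ]
  have hzτ : z ∈ (τ.erase x).erase y := hz ▸ mem_singleton_self z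
  simp only [mem_erase] at hzτ
  refine ⟨z, hzτ.2.1.symm, hzτ.1.symm, ?_⟩
  rw [← insert_erase hx, ← insert_erase (mem_erase.2 ⟨hxy.symm, hy⟩), hz]

lemma IsDisc.preconnected_linkGraph (hD : IsDisc D) (x : W) : (linkGraph D x).Preconnected := by
  rcases hD.link x with ⟨n, -, ⟨φ⟩⟩ | ⟨n, -, ⟨φ⟩⟩
  · exact φ.preconnected_iff.2 SimpleGraph.cycleGraph_preconnected
  · exact φ.preconnected_iff.2 (SimpleGraph.pathGraph_preconnected n)

lemma degree_pathGraph_le_two (n : ℕ) (i : Fin n) : (SimpleGraph.pathGraph n).degree i ≤ 2 := by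
  rcases lt_or_ge n 3 with hn | hn
  · have := (SimpleGraph.pathGraph n).degree_lt_card_verts i
    rw [Fintype.card_fin] at this
    omega
  · obtain ⟨m, rfl⟩ := Nat.exists_eq_add_of_le' hn
    rw [← SimpleGraph.cycleGraph_degree_three_le (v := i)]
    exact SimpleGraph.degree_le_of_le SimpleGraph.pathGraph_le_cycleGraph

lemma IsDisc.ncard_neighborSet_linkGraph (hD : IsDisc D) (x : W) (y : (skeleton D).neighborSet x) :
    ((linkGraph D x).neighborSet y).ncard = 1 ∨ ((linkGraph D x).neighborSet y).ncard = 2 := by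
  have ncard_eq {n : ℕ} {G : SimpleGraph (Fin n)} (φ : linkGraph D x ≃g G) :
      ((linkGraph D x).neighborSet y).ncard = G.degree (φ y) := by
    rw [← Nat.card_coe_set_eq, Nat.card_congr (φ.mapNeighborSet y), Nat.card_eq_fintype_card,
      SimpleGraph.card_neighborSet_eq_degree]
  rcases hD.link x with ⟨n, hn, ⟨φ⟩⟩ | ⟨n, hn, ⟨φ⟩⟩
  · obtain ⟨m, rfl⟩ := Nat.exists_eq_add_of_le' hn
    exact Or.inr ((ncard_eq φ).trans (by convert SimpleGraph.cycleGraph_degree_three_le))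
  · have : Nontrivial (Fin n) := Fin.nontrivial_iff_two_le.2 hn
    have hpos := (SimpleGraph.pathGraph_preconnected n).degree_pos_of_nontrivial (φ y)
    have hle := degree_pathGraph_le_two n (φ y)
    rw [ncard_eq φ]
    convert (show (SimpleGraph.pathGraph n).degree (φ y) = 1 ∨
      (SimpleGraph.pathGraph n).degree (φ y) = 2 by omega)

/-- The members of the family `C` of triangles that contain the vertices `x` and `y`. -/
def edgeStar (C : Finset (Finset W)) (x y : W) : Finset (Finset W) :=
  C.filter fun τ => x ∈ τ ∧ y ∈ τ

/-- The members of the family `C` of triangles that contain the vertex `x`. -/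
def vertexStar (C : Finset (Finset W)) (x : W) : Finset (Finset W) := C.filter fun τ => x ∈ τ

lemma mem_edgeStar {C : Finset (Finset W)} {x y : W} {τ : Finset W} :
    τ ∈ edgeStar C x y ↔ τ ∈ C ∧ x ∈ τ ∧ y ∈ τ := by simp [edgeStar]

lemma mem_vertexStar {C : Finset (Finset W)} {x : W} {τ : Finset W} :
    τ ∈ vertexStar C x ↔ τ ∈ C ∧ x ∈ τ := by simp [vertexStar]

lemma edgeStar_mono {C C' : Finset (Finset W)} (h : C ⊆ C') (x y : W) :
    edgeStar C x y ⊆ edgeStar C' x y := filter_subset_filter _ h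

lemma edgeStar_eq_filter_subset (C : Finset (Finset W)) (x y : W) :
    edgeStar C x y = C.filter fun τ => {x, y} ⊆ τ := by
  simp only [edgeStar, insert_subset_iff, singleton_subset_iff]

lemma edgeStar_eq_filter_vertexStar (C : Finset (Finset W)) (x y : W) :
    edgeStar C x y = (vertexStar C x).filter fun τ => y ∈ τ := (filter_filter _ _ C).symm

variable [Fintype W]

variable (D) in
/-- The `2`-simplices of `D`, as a `Finset`. -/
def triangleFinset : Finset (Finset W) := univ.filter (· ∈ triangles D)

lemma mem_triangleFinset {τ : Finset W} : τ ∈ triangleFinset D ↔ τ ∈ D.faces ∧ #τ = 3 :=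
  mem_filter.trans (and_iff_right (mem_univ τ))

lemma adj_of_mem_triangleFinset {τ : Finset W} (hτ : τ ∈ triangleFinset D) {x y : W} (hx : x ∈ τ)
    (hy : y ∈ τ) (hxy : x ≠ y) : (skeleton D).Adj x y :=
  adj_of_mem_face (mem_triangleFinset.1 hτ).1 hx hy hxy

lemma ne_of_triple_mem_triangleFinset {x y z : W} (h : {x, y, z} ∈ triangleFinset D) :
    x ≠ y ∧ x ≠ z ∧ y ≠ z :=
  card_triple_eq_three_iff.1 (mem_triangleFinset.1 h).2

lemma triple_mem_triangleFinset_of_adj_linkGraph {x : W} {y z : (skeleton D).neighborSet x}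
    (h : (linkGraph D x).Adj y z) : {x, y.1, z.1} ∈ triangleFinset D :=
  mem_triangleFinset.2 ⟨h.2, card_triple_eq_three_iff.2
    ⟨y.2.1, z.2.1, fun e => h.1 (Subtype.ext e)⟩⟩

lemma bijOn_neighborSet_linkGraph (x : W) (y : (skeleton D).neighborSet x) :
    Set.BijOn (fun z : (skeleton D).neighborSet x => ({x, y.1, z.1} : Finset W))
      ((linkGraph D x).neighborSet y) (edgeStar (triangleFinset D) x y) := by
  refine ⟨fun z hz => ?_, fun z hz z' _ h => ?_, fun τ hτ => ?_⟩
  · exact mem_edgeStar.2 ⟨triple_mem_triangleFinset_of_adj_linkGraph hz, by simp, by simp⟩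
  · have hne := ne_of_triple_mem_triangleFinset (triple_mem_triangleFinset_of_adj_linkGraph hz)
    have hmem : z.1 ∈ ({x, y.1, z'.1} : Finset W) := h.subset (by simp)
    simp only [mem_insert, mem_singleton, hne.2.1.symm, hne.2.2.symm, false_or] at hmem
    exact Subtype.ext hmem
  · obtain ⟨hτT, hx, hy⟩ := mem_edgeStar.1 hτ
    obtain ⟨z, hxz, hyz, rfl⟩ := exists_eq_triple (mem_triangleFinset.1 hτT).2 hx hy y.2.1
    exact ⟨⟨z, adj_of_mem_triangleFinset hτT hx (by simp) hxz⟩,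
      ⟨fun e => hyz (congrArg Subtype.val e), (mem_triangleFinset.1 hτT).1⟩, rfl⟩

lemma IsDisc.card_edgeStar (hD : IsDisc D) {x y : W} (h : (skeleton D).Adj x y) :
    #(edgeStar (triangleFinset D) x y) = 1 ∨ #(edgeStar (triangleFinset D) x y) = 2 := by
  have := hD.ncard_neighborSet_linkGraph x ⟨y, h⟩
  have hbij := bijOn_neighborSet_linkGraph x ⟨y, h⟩
  rwa [← hbij.injOn.ncard_image, hbij.image_eq, Set.ncard_coe_finset] at this

lemma IsDisc.card_edgeStar_le_two (hD : IsDisc D) {x y : W} (h : x ≠ y) :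
    #(edgeStar (triangleFinset D) x y) ≤ 2 := by
  by_cases hxy : (skeleton D).Adj x y
  · rcases hD.card_edgeStar hxy with h | h <;> omega
  · have : edgeStar (triangleFinset D) x y = ∅ := eq_empty_of_forall_notMem fun τ hτ =>
      hxy (adj_of_mem_triangleFinset (mem_edgeStar.1 hτ).1 (mem_edgeStar.1 hτ).2.1
        (mem_edgeStar.1 hτ).2.2 h)
    simp [this]

lemma isBoundaryVertex_iff {x : W} : IsBoundaryVertex D x ↔
    ∃ y, (skeleton D).Adj x y ∧ #(edgeStar (triangleFinset D) x y) = 1 := by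
  have key {x y : W} : #(edgeStar (triangleFinset D) x y) = 1 ↔
      ∃! τ, τ ∈ triangles D ∧ {x, y} ⊆ τ := by
    simp only [card_eq_one, edgeStar_eq_filter_subset, triangleFinset, eq_singleton_iff_unique_mem,
      mem_filter, mem_univ, true_and, ExistsUnique]
  constructor
  · rintro ⟨e, ⟨he, h2, huniq⟩, hx⟩
    obtain ⟨y, hy, hyx⟩ := exists_mem_ne (show 1 < #e by omega) x
    obtain rfl : {x, y} = e := eq_of_subset_of_card_le (by simp [insert_subset_iff, hx, hy])
      (by rw [card_pair hyx.symm, h2])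
    exact ⟨y, ⟨hyx.symm, he⟩, key.2 huniq⟩
  · rintro ⟨y, hxy, h1⟩
    exact ⟨{x, y}, ⟨hxy.2, card_pair hxy.1, key.1 h1⟩, by simp⟩

lemma IsDisc.card_edgeStar_of_interior (hD : IsDisc D) {x y : W} (h : (skeleton D).Adj x y)
    (hx : IsInteriorVertex D x) : #(edgeStar (triangleFinset D) x y) = 2 :=
  (hD.card_edgeStar h).resolve_left fun h1 => hx (isBoundaryVertex_iff.2 ⟨y, h, h1⟩)

/-- The triangles at a vertex are connected through their common edges, because its link is. -/
lemma IsDisc.vertexStar_induction (hD : IsDisc D) {x : W} {Q : Finset W → Prop}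
    (hQ : ∀ y ≠ x, ∀ σ ∈ edgeStar (triangleFinset D) x y, ∀ τ ∈ edgeStar (triangleFinset D) x y,
      Q σ → Q τ)
    {σ τ : Finset W} (hσ : σ ∈ vertexStar (triangleFinset D) x)
    (hτ : τ ∈ vertexStar (triangleFinset D) x) (h : Q σ) : Q τ := by
  have exists_neighbor : ∀ ρ ∈ vertexStar (triangleFinset D) x,
      ∃ y : (skeleton D).neighborSet x, ρ ∈ edgeStar (triangleFinset D) x y := by
    intro ρ hρ
    obtain ⟨hρT, hx⟩ := mem_vertexStar.1 hρ
    have h3 := (mem_triangleFinset.1 hρT).2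
    obtain ⟨y, hy, hyx⟩ := exists_mem_ne (show 1 < #ρ by omega) x
    exact ⟨⟨y, adj_of_mem_triangleFinset hρT hx hy hyx.symm⟩, mem_edgeStar.2 ⟨hρT, hx, hy⟩⟩
  have along_walk {a b : (skeleton D).neighborSet x} (p : (linkGraph D x).Walk a b) :
      (∀ σ ∈ edgeStar (triangleFinset D) x a, Q σ) →
        ∀ τ ∈ edgeStar (triangleFinset D) x b, Q τ := by
    induction p with
    | nil => exact id
    | @cons a c _ hac _ ih =>
      intro ha
      have hmem := triple_mem_triangleFinset_of_adj_linkGraph hac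
      exact ih fun τ hτ => hQ c c.2.1.symm _ (mem_edgeStar.2 ⟨hmem, by simp, by simp⟩) τ hτ
        (ha _ (mem_edgeStar.2 ⟨hmem, by simp, by simp⟩))
  obtain ⟨a, ha⟩ := exists_neighbor σ hσ
  obtain ⟨b, hb⟩ := exists_neighbor τ hτ
  obtain ⟨p⟩ := hD.preconnected_linkGraph x a b
  exact along_walk p (fun ρ hρ => hQ a a.2.1.symm σ ha ρ hρ h) τ hb

lemma sum_card_edgeStar {C : Finset (Finset W)} (hC : C ⊆ triangleFinset D) (x : W) :
    ∑ y ∈ univ.erase x, #(edgeStar C x y) = 2 * #(vertexStar C x) := by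
  simp_rw [edgeStar_eq_filter_vertexStar]
  refine (sum_card_bipartiteAbove_eq_sum_card_bipartiteBelow fun y τ => y ∈ τ).trans ?_
  rw [mul_comm]
  refine sum_const_nat fun τ hτ => ?_
  rw [mem_vertexStar] at hτ
  have : (univ.erase x).filter (fun y => y ∈ τ) = τ.erase x := by ext; simp
  rw [bipartiteBelow, this, card_erase_of_mem hτ.2, (mem_triangleFinset.1 (hC hτ.1)).2]

lemma IsDisc.card_vertexStar_of_interior (hD : IsDisc D) {x : W} (hx : IsInteriorVertex D x) :
    #(vertexStar (triangleFinset D) x) = ((skeleton D).neighborSet x).ncard := by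
  have card_edgeStar : ∀ y ∈ univ.erase x,
      #(edgeStar (triangleFinset D) x y) = if (skeleton D).Adj x y then 2 else 0 := by
    intro y hy
    split_ifs with hxy
    · exact hD.card_edgeStar_of_interior hxy hx
    · refine card_eq_zero.2 (eq_empty_of_forall_notMem fun τ hτ => hxy ?_)
      obtain ⟨hτT, hxτ, hyτ⟩ := mem_edgeStar.1 hτ
      exact adj_of_mem_triangleFinset hτT hxτ hyτ (ne_of_mem_erase hy).symm
  have neighborSet_eq :
      (skeleton D).neighborSet x = {y ∈ univ.erase x | (skeleton D).Adj x y} := by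
    ext y
    simpa using fun h : (skeleton D).Adj x y => h.ne'
  have := sum_card_edgeStar (subset_refl (triangleFinset D)) x
  rw [sum_congr rfl card_edgeStar, ← sum_filter, sum_const, smul_eq_mul] at this
  rw [neighborSet_eq, Set.ncard_coe_finset]
  omega

lemma IsDisc.eq_or_eq_of_mem_edgeStar (hD : IsDisc D) {x a b c : W} (hbc : b ≠ c)
    (hb : {x, a, b} ∈ triangleFinset D) (hc : {x, a, c} ∈ triangleFinset D) {ρ : Finset W}
    (hρ : ρ ∈ edgeStar (triangleFinset D) x a) : ρ = {x, a, b} ∨ ρ = {x, a, c} := by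
  obtain ⟨hxa, hxb, hab⟩ := ne_of_triple_mem_triangleFinset hb
  have hne : ({x, a, b} : Finset W) ≠ {x, a, c} := fun h => by
    have : b ∈ ({x, a, c} : Finset W) := h ▸ (by simp)
    simp [hxb.symm, hab.symm, hbc] at this
  have hsub : {{x, a, b}, {x, a, c}} ⊆ edgeStar (triangleFinset D) x a := by
    simp [insert_subset_iff, mem_edgeStar, hb, hc]
  have heq := eq_of_subset_of_card_le hsub
    ((hD.card_edgeStar_le_two hxa).trans_eq (card_pair hne).symm)
  simpa [← heq] using hρ

lemma IsDisc.eq_of_mem_vertexStar_of_link_triangle (hD : IsDisc D) {x a b c : W}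
    (hab : {x, a, b} ∈ triangleFinset D) (hac : {x, a, c} ∈ triangleFinset D)
    (hbc : {x, b, c} ∈ triangleFinset D) :
    ∀ τ ∈ vertexStar (triangleFinset D) x, τ = {x, a, b} ∨ τ = {x, a, c} ∨ τ = {x, b, c} := by
  obtain ⟨-, -, nab⟩ := ne_of_triple_mem_triangleFinset hab
  obtain ⟨-, -, nac⟩ := ne_of_triple_mem_triangleFinset hac
  obtain ⟨-, -, nbc⟩ := ne_of_triple_mem_triangleFinset hbc
  intro τ hτ
  refine hD.vertexStar_induction (Q := fun τ => τ = {x, a, b} ∨ τ = {x, a, c} ∨ τ = {x, b, c})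
    (fun y hy σ hσ ρ hρ hmem => ?_) (mem_vertexStar.2 ⟨hab, by simp⟩) hτ (Or.inl rfl)
  have hyσ := (mem_edgeStar.1 hσ).2.2
  have hba : {x, b, a} ∈ triangleFinset D := by rwa [pair_comm]
  have hca : {x, c, a} ∈ triangleFinset D := by rwa [pair_comm]
  have hcb : {x, c, b} ∈ triangleFinset D := by rwa [pair_comm]
  have hy_cases : y = a ∨ y = b ∨ y = c := by
    rcases hmem with rfl | rfl | rfl <;>
      simp only [mem_insert, mem_singleton, hy, false_or] at hyσ <;> tauto
  rcases hy_cases with rfl | rfl | rfl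
  · exact (hD.eq_or_eq_of_mem_edgeStar nbc hab hac hρ).imp_right Or.inl
  · rw [pair_comm a y]
    exact (hD.eq_or_eq_of_mem_edgeStar nac hba hbc hρ).imp_right Or.inr
  · rw [pair_comm a y, pair_comm b y]
    exact Or.inr (hD.eq_or_eq_of_mem_edgeStar nab hca hcb hρ)

lemma IsDisc.not_link_triangle (hD : IsDisc D) {x a b c : W} (hx : IsInteriorVertex D x)
    (hdeg : 4 ≤ ((skeleton D).neighborSet x).ncard)
    (hab : {x, a, b} ∈ triangleFinset D) (hac : {x, a, c} ∈ triangleFinset D) :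
    {x, b, c} ∉ triangleFinset D := fun hbc => by
  have hsub : vertexStar (triangleFinset D) x ⊆ {{x, a, b}, {x, a, c}, {x, b, c}} := fun τ hτ => by
    simpa using hD.eq_of_mem_vertexStar_of_link_triangle hab hac hbc τ hτ
  have h := (card_le_card hsub).trans card_le_three
  rw [hD.card_vertexStar_of_interior hx] at h
  omega

end Local

section Chains

variable {W : Type*}

/-- The `1`-chain (with coefficients in `ZMod 2`) of the edge `{a, b}`. -/
def edgeChain (a b : W) : Finset W → ZMod 2 := Pi.single {a, b} 1

lemma edgeChain_comm (a b : W) : edgeChain a b = edgeChain b a := by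
  rw [edgeChain, edgeChain, pair_comm]

/-- The boundary of the `2`-chain (with coefficients in `ZMod 2`) with support `C`. -/
def triangleBoundary (C : Finset (Finset W)) : Finset W → ZMod 2 :=
  ∑ τ ∈ C, ∑ e ∈ powersetCard 2 τ, Pi.single e 1

lemma triangleBoundary_apply (C : Finset (Finset W)) (e : Finset W) :
    triangleBoundary C e = if #e = 2 then (#{τ ∈ C | e ⊆ τ} : ZMod 2) else 0 := by
  simp only [triangleBoundary, Finset.sum_apply, Pi.single_apply, sum_ite_eq, mem_powersetCard]
  split_ifs with he <;> simp [he]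

lemma triangleBoundary_eq_sum (C : Finset (Finset W)) :
    triangleBoundary C = ∑ τ ∈ C, triangleBoundary {τ} := by
  simp only [triangleBoundary, sum_singleton]

lemma triangleBoundary_pair (C : Finset (Finset W)) {a b : W} (h : a ≠ b) :
    triangleBoundary C {a, b} = (#(edgeStar C a b) : ZMod 2) := by
  rw [triangleBoundary_apply, if_pos (card_pair h), edgeStar_eq_filter_subset]

lemma triangleBoundary_triple {a b c : W} (hab : a ≠ b) (hac : a ≠ c) (hbc : b ≠ c) :
    triangleBoundary {{a, b, c}} = edgeChain a b + edgeChain b c + edgeChain a c := by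
  have pairs_ne {x y z : W} (hxy : x ≠ y) (hxz : x ≠ z) : ({x, y} : Finset W) ≠ {y, z} :=
    fun h => by simpa [hxy, hxz] using h.subset (mem_insert_self x {y})
  have nab : ({a, b} : Finset W) ∉ ({{b, c}, {a, c}} : Finset (Finset W)) := by
    simpa [pairs_ne hab hac] using pair_comm b a ▸ pairs_ne hab.symm hbc
  have nbc : ({b, c} : Finset W) ≠ {a, c} := pair_comm c a ▸ pairs_ne hbc hab.symm
  have edges : powersetCard 2 ({a, b, c} : Finset W) = {{a, b}, {b, c}, {a, c}} := by
    refine (eq_of_subset_of_card_le ?_ ?_).symm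
    · simp [insert_subset_iff, *]
    · rw [card_powersetCard, card_triple_eq_three_iff.2 ⟨hab, hac, hbc⟩, card_insert_of_notMem nab,
        card_pair nbc]
      rfl
  rw [triangleBoundary, sum_singleton, edges, sum_insert nab, sum_pair nbc, ← add_assoc]
  rfl

lemma triangleBoundary_symmDiff (C C' : Finset (Finset W)) :
    triangleBoundary (symmDiff C C') = triangleBoundary C + triangleBoundary C' := by
  have extend (A : Finset (Finset W)) (hA : A ⊆ C ∪ C') : triangleBoundary A =
      ∑ τ ∈ C ∪ C', if τ ∈ A then ∑ e ∈ powersetCard 2 τ, Pi.single e (1 : ZMod 2) else 0 := by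
    rw [triangleBoundary, sum_ite_mem, inter_eq_right.2 hA]
  rw [extend _ symmDiff_le_sup, extend C subset_union_left, extend C' subset_union_right,
    ← sum_add_distrib]
  refine sum_congr rfl fun τ _ => ?_
  by_cases h1 : τ ∈ C <;> by_cases h2 : τ ∈ C' <;>
    simp [mem_symmDiff, h1, h2, ZModModule.add_self]

/-- The chains of edges that bound a set of triangles of `D`. -/
def boundaries [Fintype W] (D : AbstractSimplicialComplex W) :
    AddSubmonoid (Finset W → ZMod 2) where
  carrier := {z | ∃ C ⊆ triangleFinset D, triangleBoundary C = z}
  zero_mem' := ⟨∅, empty_subset _, rfl⟩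
  add_mem' := by
    rintro _ _ ⟨C, hC, rfl⟩ ⟨C', hC', rfl⟩
    exact ⟨symmDiff C C', symmDiff_le_sup.trans (union_subset hC hC'),
      triangleBoundary_symmDiff C C'⟩

variable {D : AbstractSimplicialComplex W}

/-- The `1`-chain of an edge path. -/
def walkChain : {a b : W} → (skeleton D).Walk a b → Finset W → ZMod 2
  | _, _, .nil => 0
  | a, _, .cons (v := b) _ p => edgeChain a b + walkChain p

lemma walkChain_append {a b c : W} (p : (skeleton D).Walk a b) (q : (skeleton D).Walk b c) :
    walkChain (p.append q) = walkChain p + walkChain q := by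
  induction p with
  | nil => simp [walkChain]
  | cons h p ih => simp [walkChain, ih, add_assoc]

lemma walkChain_reverse {a b : W} (p : (skeleton D).Walk a b) :
    walkChain p.reverse = walkChain p := by
  induction p with
  | nil => simp [walkChain]
  | @cons a b _ _ _ ih =>
    rw [SimpleGraph.Walk.reverse_cons, walkChain_append, ih, walkChain, walkChain, walkChain,
      add_zero, edgeChain_comm, add_comm]

variable [Fintype W]

lemma Homotopic.walkChain_add_mem_boundaries {a b : W} {p q : (skeleton D).Walk a b}
    (h : Homotopic D p q) : walkChain p + walkChain q ∈ boundaries D := by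
  induction h with
  | refl p => exact ZModModule.add_self (walkChain p) ▸ zero_mem _
  | symm _ ih => rwa [add_comm]
  | @trans _ _ p q r _ _ ih1 ih2 =>
    exact ZModModule.add_add_add_cancel (walkChain p) (walkChain q) (walkChain r) ▸ add_mem ih1 ih2
  | @cons a b _ _ p q _ ih =>
    rwa [walkChain, walkChain, add_add_add_comm, ZModModule.add_self, zero_add]
  | @backtrack a b _ _ _ p =>
    rw [walkChain, walkChain, edgeChain_comm b a, ← add_assoc, ZModModule.add_self, zero_add,
      ZModModule.add_self]
    exact zero_mem _
  | @triangle a b c _ hab hbc hac hface p =>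
    refine ⟨{{a, b, c}}, singleton_subset_iff.2 (mem_triangleFinset.2
      ⟨hface, card_triple_eq_three_iff.2 ⟨hab.1, hac.1, hbc.1⟩⟩), ?_⟩
    rw [triangleBoundary_triple hab.1 hac.1 hbc.1, walkChain, walkChain, walkChain,
      ← add_assoc (edgeChain a b) (edgeChain b c), add_add_add_comm, ZModModule.add_self, add_zero]

/-- The boundary of a `1`-chain. -/
def edgeBoundary : (Finset W → ZMod 2) →ₗ[ZMod 2] (W → ZMod 2) :=
  LinearMap.pi fun x => ∑ e with x ∈ e, LinearMap.proj e

lemma edgeBoundary_apply (z : Finset W → ZMod 2) (x : W) :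
    edgeBoundary z x = ∑ e with x ∈ e, z e := by
  simp [edgeBoundary]

lemma edgeBoundary_edgeChain {a b : W} (h : a ≠ b) :
    edgeBoundary (edgeChain a b) = Pi.single a 1 + Pi.single b 1 := by
  ext x
  simp only [edgeBoundary_apply, edgeChain, Pi.single_apply, sum_ite_eq', mem_filter, mem_univ,
    true_and, mem_insert, mem_singleton, Pi.add_apply]
  by_cases h1 : x = a <;> by_cases h2 : x = b <;> simp_all

lemma edgeBoundary_triangleBoundary {C : Finset (Finset W)} (hC : ∀ τ ∈ C, #τ = 3) :
    edgeBoundary (triangleBoundary C) = 0 := by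
  have boundary_singleton : ∀ τ ∈ C, edgeBoundary (triangleBoundary {τ}) = 0 := by
    intro τ hτ
    obtain ⟨a, b, c, hab, hac, hbc, rfl⟩ := card_eq_three.1 (hC τ hτ)
    rw [triangleBoundary_triple hab hac hbc, map_add, map_add, edgeBoundary_edgeChain hab,
      edgeBoundary_edgeChain hbc, edgeBoundary_edgeChain hac,
      ZModModule.add_add_add_cancel, ZModModule.add_self]
  rw [triangleBoundary_eq_sum, map_sum]
  exact sum_eq_zero boundary_singleton

/-- In a simply connected complex every `1`-cycle with coefficients in `ZMod 2` is a boundary: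
cone off each edge with paths from its endpoints to a base point. -/
lemma IsSimplyConnected.mem_boundaries (hD : IsSimplyConnected D) {z : Finset W → ZMod 2}
    (hz : ∀ e, z e ≠ 0 → e ∈ D.faces ∧ #e = 2) (hcycle : edgeBoundary z = 0) :
    z ∈ boundaries D := by
  obtain ⟨v⟩ := hD.connected.nonempty
  let P (w : W) : (skeleton D).Walk v w := (hD.connected.preconnected v w).some
  let H : (W → ZMod 2) →ₗ[ZMod 2] (Finset W → ZMod 2) :=
    Fintype.linearCombination (ZMod 2) fun w => walkChain (P w)
  have H_single (w : W) : H (Pi.single w 1) = walkChain (P w) := by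
    rw [Fintype.linearCombination_apply_single, one_smul]
  have z_eq_sum : z = ∑ e with z e ≠ 0, Pi.single e 1 := by
    have eq_ite : ∀ a : ZMod 2, a = if a ≠ 0 then 1 else 0 := by decide
    ext e
    simpa only [Finset.sum_apply, Pi.single_apply, sum_ite_eq, mem_filter, mem_univ, true_and]
      using eq_ite (z e)
  have cone_mem : z + H (edgeBoundary z) ∈ boundaries D := by
    rw [z_eq_sum, map_sum, map_sum, ← sum_add_distrib]
    refine sum_mem fun e he => ?_
    obtain ⟨heD, hcard⟩ := hz e (mem_filter.1 he).2
    obtain ⟨a, b, hab, rfl⟩ := card_eq_two.1 hcard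
    change edgeChain a b + H (edgeBoundary (edgeChain a b)) ∈ _
    have hadj : (skeleton D).Adj a b := ⟨hab, heD⟩
    have := (hD.null_homotopic v ((P a).append ((SimpleGraph.Walk.cons hadj .nil).append
      (P b).reverse))).walkChain_add_mem_boundaries
    simp only [walkChain_append, walkChain_reverse, walkChain, add_zero] at this
    rw [edgeBoundary_edgeChain hab, map_add, H_single, H_single]
    convert this using 1
    abel
  simpa [hcycle] using cone_mem

lemma IsDisc.edgeStar_of_triangleBoundary_eq_zero (hD : IsDisc D) {C : Finset (Finset W)}
    (hC : C ⊆ triangleFinset D) {x y : W} (hxy : x ≠ y) (h0 : triangleBoundary C {x, y} = 0)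
    (hne : (edgeStar C x y).Nonempty) :
    edgeStar C x y = edgeStar (triangleFinset D) x y ∧
      #(edgeStar (triangleFinset D) x y) = 2 := by
  rw [triangleBoundary_pair C hxy, ZMod.natCast_eq_zero_iff] at h0
  have hpos := hne.card_pos
  have hle := hD.card_edgeStar_le_two hxy
  have hmono := edgeStar_mono hC x y
  have hcard := card_le_card hmono
  exact ⟨eq_of_subset_of_card_le hmono (by omega), by omega⟩

lemma IsDisc.vertexStar_of_triangleBoundary_eq_zero (hD : IsDisc D) {C : Finset (Finset W)}
    (hC : C ⊆ triangleFinset D) {x : W} (h0 : ∀ y, y ≠ x → triangleBoundary C {x, y} = 0)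
    (hne : (vertexStar C x).Nonempty) :
    vertexStar (triangleFinset D) x ⊆ C ∧ IsInteriorVertex D x := by
  obtain ⟨σ, hσ⟩ := hne
  obtain ⟨hσC, hxσ⟩ := mem_vertexStar.1 hσ
  have subset : vertexStar (triangleFinset D) x ⊆ C := fun τ hτ => by
    refine hD.vertexStar_induction (Q := (· ∈ C)) (fun y hy ρ hρ ρ' hρ' hρC => ?_)
      (mem_vertexStar.2 ⟨hC hσC, hxσ⟩) hτ hσC
    have heq := (hD.edgeStar_of_triangleBoundary_eq_zero hC hy.symm (h0 y hy)
      ⟨ρ, mem_edgeStar.2 ⟨hρC, (mem_edgeStar.1 hρ).2⟩⟩).1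
    exact (mem_edgeStar.1 (heq ▸ hρ')).1
  refine ⟨subset, fun hx => ?_⟩
  obtain ⟨y, hxy, h1⟩ := isBoundaryVertex_iff.1 hx
  obtain ⟨τ, hτ⟩ := card_pos.1 (h1.symm ▸ one_pos)
  obtain ⟨hτT, hxτ, hyτ⟩ := mem_edgeStar.1 hτ
  have hτC := subset (mem_vertexStar.2 ⟨hτT, hxτ⟩)
  have := (hD.edgeStar_of_triangleBoundary_eq_zero hC hxy.1 (h0 y hxy.1.symm)
    ⟨τ, mem_edgeStar.2 ⟨hτC, hxτ, hyτ⟩⟩).2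
  omega

lemma IsDisc.eq_empty_of_triangleBoundary_eq_zero (hD : IsDisc D) {C : Finset (Finset W)}
    (hC : C ⊆ triangleFinset D) (h : triangleBoundary C = 0) : C = ∅ := by
  by_contra hne
  have star {x : W} := hD.vertexStar_of_triangleBoundary_eq_zero hC (x := x) fun y _ => by
    rw [h, Pi.zero_apply]
  have along_walk {x y : W} (p : (skeleton D).Walk x y) :
      (vertexStar C x).Nonempty → (vertexStar C y).Nonempty := by
    induction p with
    | nil => exact id
    | @cons x y _ hxy _ ih =>
      intro hx
      obtain ⟨τ, hτ⟩ : (edgeStar (triangleFinset D) x y).Nonempty := card_pos.1 (by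
        rcases hD.card_edgeStar hxy with h | h <;> omega)
      obtain ⟨hτT, hxτ, hyτ⟩ := mem_edgeStar.1 hτ
      exact ih ⟨τ, mem_vertexStar.2 ⟨(star hx).1 (mem_vertexStar.2 ⟨hτT, hxτ⟩), hyτ⟩⟩
  obtain ⟨τ, hτ⟩ := nonempty_iff_ne_empty.2 hne
  obtain ⟨x, hx⟩ : τ.Nonempty := (D.isRelLowerSet_faces (mem_triangleFinset.1 (hC hτ)).1).1
  obtain ⟨v, hv⟩ := hD.boundary_nonempty
  obtain ⟨p⟩ := hD.simplyConnected.connected.preconnected x v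
  exact (star (along_walk p ⟨τ, mem_vertexStar.2 ⟨hτ, hx⟩⟩)).2 hv

end Chains

section Euler

variable {W : Type*} {C : Finset (Finset W)}

/-- The vertices of a set of triangles. -/
def verts (C : Finset (Finset W)) : Finset W := C.biUnion id

/-- The edges of a set of triangles. -/
def edges (C : Finset (Finset W)) : Finset (Finset W) := C.biUnion (powersetCard 2)

lemma mem_verts {x : W} : x ∈ verts C ↔ ∃ τ ∈ C, x ∈ τ := by
  simp [verts]

lemma mem_edges {e : Finset W} : e ∈ edges C ↔ #e = 2 ∧ ∃ τ ∈ C, e ⊆ τ := by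
  simp only [edges, mem_biUnion, mem_powersetCard]
  tauto

lemma mem_verts_of_mem_edges {e : Finset W} (he : e ∈ edges C) {x : W} (hx : x ∈ e) :
    x ∈ verts C := by
  obtain ⟨-, τ, hτ, hsub⟩ := mem_edges.1 he
  exact mem_verts.2 ⟨τ, hτ, hsub hx⟩

lemma pair_mem_edges {x y : W} (hxy : x ≠ y) :
    {x, y} ∈ edges C ↔ (edgeStar C x y).Nonempty := by
  simp [mem_edges, card_pair hxy, Finset.Nonempty, mem_edgeStar, insert_subset_iff]

lemma sum_card_vertexStar (h3 : ∀ τ ∈ C, #τ = 3) :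
    ∑ x ∈ verts C, #(vertexStar C x) = 3 * #C := by
  refine (sum_card_bipartiteAbove_eq_sum_card_bipartiteBelow fun x τ => x ∈ τ).trans ?_
  rw [mul_comm]
  refine sum_const_nat fun τ hτ => ?_
  have : {x ∈ verts C | x ∈ τ} = τ := by
    ext x
    simpa using fun hx => mem_verts.2 ⟨τ, hτ, hx⟩
  rw [bipartiteBelow, this, h3 τ hτ]

lemma sum_card_filter_subset (h3 : ∀ τ ∈ C, #τ = 3) :
    ∑ e ∈ edges C, #{τ ∈ C | e ⊆ τ} = 3 * #C := by
  refine (sum_card_bipartiteAbove_eq_sum_card_bipartiteBelow fun (e : Finset W) τ => e ⊆ τ).trans ?_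
  rw [mul_comm]
  refine sum_const_nat fun τ hτ => ?_
  have : {e ∈ edges C | e ⊆ τ} = powersetCard 2 τ := by
    ext e
    simp only [mem_filter, mem_powersetCard, mem_edges]
    exact ⟨fun h => ⟨h.2, h.1.1⟩, fun h => ⟨⟨h.2, τ, hτ, h.1⟩, h.1⟩⟩
  rw [bipartiteBelow, this, card_powersetCard, h3 τ hτ]
  rfl

variable [Fintype W]

variable (C) in
/-- The boundary map from the `1`-chains to the `0`-chains of the complex generated by `C`. -/
def edgeBoundaryOn : (edges C → ZMod 2) →ₗ[ZMod 2] (verts C → ZMod 2) :=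
  LinearMap.funLeft (ZMod 2) (ZMod 2) Subtype.val ∘ₗ edgeBoundary ∘ₗ
    Function.ExtendByZero.linearMap (ZMod 2) Subtype.val

lemma finrank_range_edgeBoundaryOn_lt (hne : (verts C).Nonempty) :
    Module.finrank (ZMod 2) (LinearMap.range (edgeBoundaryOn C)) + 1 ≤ #(verts C) := by
  let total : Module.Dual (ZMod 2) (verts C → ZMod 2) := ∑ x, LinearMap.proj x
  have total_ne_zero : total ≠ 0 := by
    obtain ⟨x, hx⟩ := hne
    intro h
    simpa [total] using LinearMap.congr_fun h (Pi.single ⟨x, hx⟩ 1)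
  have total_comp : total ∘ₗ edgeBoundaryOn C = 0 := by
    refine LinearMap.pi_ext' fun e => LinearMap.ext_ring ?_
    obtain ⟨a, b, hab, he⟩ := card_eq_two.1 (mem_edges.1 e.2).1
    have extend_single :
        Function.ExtendByZero.linearMap (ZMod 2) Subtype.val (Pi.single e 1) = edgeChain a b := by
      change Function.extend Subtype.val (Pi.single e 1) 0 = _
      rw [edgeChain, ← he]
      ext e'
      by_cases he' : e' ∈ edges C
      · exact (Subtype.val_injective.extend_apply _ _ ⟨e', he'⟩).trans
          (by simp [Pi.single_apply, Subtype.ext_iff])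
      · rw [Function.extend_apply' _ _ _ (by simpa using he'),
          Pi.single_eq_of_ne (by rintro rfl; exact he' e.2), Pi.zero_apply]
    have ha : a ∈ verts C := mem_verts_of_mem_edges e.2 (by simp [he])
    have hb : b ∈ verts C := mem_verts_of_mem_edges e.2 (by simp [he])
    calc total (edgeBoundaryOn C (Pi.single e 1))
        = ∑ x : verts C, (Pi.single a 1 + Pi.single b 1 : W → ZMod 2) x := by
          simp [total, edgeBoundaryOn, extend_single, edgeBoundary_edgeChain hab]
      _ = 0 := by
          rw [sum_coe_sort (verts C) (Pi.single a 1 + Pi.single b 1 : W → ZMod 2)]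
          simp [sum_add_distrib, ha, hb, CharTwo.add_self_eq_zero]
  have range_le : LinearMap.range (edgeBoundaryOn C) ≤ LinearMap.ker total := by
    rwa [LinearMap.range_le_ker_iff]
  have := Module.Dual.finrank_ker_add_one_of_ne_zero total_ne_zero
  rw [Module.finrank_fintype_fun_eq_card, Fintype.card_coe] at this
  rw [← this]
  gcongr
  exact Submodule.finrank_mono range_le

lemma finrank_ker_edgeBoundaryOn_le
    (hbound : ∀ z : Finset W → ZMod 2, (∀ e, z e ≠ 0 → e ∈ edges C) → edgeBoundary z = 0 →
      ∃ C' ⊆ C, triangleBoundary C' = z) :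
    Module.finrank (ZMod 2) (LinearMap.ker (edgeBoundaryOn C)) ≤ #C := by
  let b (τ : Finset W) : edges C → ZMod 2 := fun e => triangleBoundary {τ} e
  have ker_le : LinearMap.ker (edgeBoundaryOn C) ≤ Submodule.span (ZMod 2) (C.image b) := by
    intro g hg
    let z : Finset W → ZMod 2 := Function.extend Subtype.val g 0
    have z_off {e : Finset W} (he : e ∉ edges C) : z e = 0 :=
      Function.extend_apply' _ _ _ (by simpa using he)
    have z_cycle : edgeBoundary z = 0 := by
      ext x
      by_cases hx : x ∈ verts C
      · exact congrFun hg ⟨x, hx⟩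
      · rw [edgeBoundary_apply]
        exact sum_eq_zero fun e he =>
          z_off fun heC => hx (mem_verts_of_mem_edges heC (mem_filter.1 he).2)
    obtain ⟨C', hC', hz⟩ := hbound z (fun e => not_imp_comm.1 z_off) z_cycle
    have g_eq : g = ∑ τ ∈ C', b τ := by
      ext e
      rw [← Subtype.val_injective.extend_apply g 0 e, Finset.sum_apply]
      change z e = _
      rw [← hz, triangleBoundary_eq_sum, Finset.sum_apply]
    rw [g_eq]
    exact sum_mem fun τ hτ => Submodule.subset_span (mem_image_of_mem b (hC' hτ))
  exact (Submodule.finrank_mono ker_le).trans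
    ((finrank_span_finset_le_card _).trans card_image_le)

/-- Euler's inequality. -/
lemma card_edges_lt (hne : (verts C).Nonempty)
    (hbound : ∀ z : Finset W → ZMod 2, (∀ e, z e ≠ 0 → e ∈ edges C) → edgeBoundary z = 0 →
      ∃ C' ⊆ C, triangleBoundary C' = z) :
    #(edges C) + 1 ≤ #(verts C) + #C := by
  have hrank := LinearMap.finrank_range_add_finrank_ker (edgeBoundaryOn C)
  have hrange := finrank_range_edgeBoundaryOn_lt hne
  have hker := finrank_ker_edgeBoundaryOn_le hbound
  rw [Module.finrank_fintype_fun_eq_card, Fintype.card_coe] at hrank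
  omega

end Euler

section Polygon

variable {W : Type*}

/-- The mod `2` chain of the edge path `c 0, …, c n`. -/
def pathChain (c : ℕ → W) (n : ℕ) : Finset W → ZMod 2 :=
  ∑ i ∈ range n, edgeChain (c i) (c (i + 1))

/-- The edges of the edge path `c 0, …, c n`. -/
def pathEdges (c : ℕ → W) (n : ℕ) : Finset (Finset W) :=
  (range n).image fun i => {c i, c (i + 1)}

lemma mem_pathEdges {c : ℕ → W} {n : ℕ} {e : Finset W} :
    e ∈ pathEdges c n ↔ ∃ i < n, {c i, c (i + 1)} = e := by
  simp [pathEdges]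

lemma pathChain_eq_zero {c : ℕ → W} {n : ℕ} {e : Finset W} (he : e ∉ pathEdges c n) :
    pathChain c n e = 0 := by
  rw [pathChain, Finset.sum_apply]
  refine sum_eq_zero fun i hi => Pi.single_eq_of_ne ?_ _
  rintro rfl
  exact he (mem_pathEdges.2 ⟨i, mem_range.1 hi, rfl⟩)

lemma pathChain_update (c : ℕ → W) (w : W) {n i : ℕ} (hi : i + 1 < n) :
    pathChain (Function.update c (i + 1) w) n = pathChain c n +
      (edgeChain (c i) (c (i + 1)) + edgeChain (c (i + 1)) (c (i + 2)) +
        (edgeChain (c i) w + edgeChain w (c (i + 2)))) := by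
  have split (f : ℕ → Finset W → ZMod 2) :
      ∑ k ∈ range n, f k = ∑ k ∈ range n \ {i, i + 1}, f k + (f i + f (i + 1)) := by
    rw [← sum_pair (by omega), sum_sdiff]
    grind
  have update_ne {k : ℕ} (hk : k ≠ i + 1) : Function.update c (i + 1) w k = c k :=
    Function.update_of_ne hk ..
  have off : ∑ k ∈ range n \ {i, i + 1}, edgeChain (Function.update c (i + 1) w k)
        (Function.update c (i + 1) w (k + 1)) =
      ∑ k ∈ range n \ {i, i + 1}, edgeChain (c k) (c (k + 1)) := by
    refine sum_congr rfl fun k hk => ?_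
    simp only [mem_sdiff, mem_insert, mem_singleton, not_or] at hk
    rw [update_ne (by omega), update_ne (by omega)]
  rw [pathChain, pathChain, split, split, off, Function.update_self, update_ne (by omega),
    update_ne (by omega)]
  linear_combination -ZModModule.add_self (edgeChain (c i) (c (i + 1)) +
    edgeChain (c (i + 1)) (c (i + 2)))

/-- A closed edge path of length `n`, parametrized by natural numbers: only the values `c i` with
`i ≤ n` matter. -/
structure IsClosedPath (D : AbstractSimplicialComplex W) (n : ℕ) (c : ℕ → W) : Prop where
  closed : c n = c 0
  adj : ∀ i < n, (skeleton D).Adj (c i) (c (i + 1))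

variable [Fintype W] {D : AbstractSimplicialComplex W} {n : ℕ} {c : ℕ → W}
  {C : Finset (Finset W)}

lemma IsClosedPath.edgeBoundary_pathChain (h : IsClosedPath D n c) :
    edgeBoundary (pathChain c n) = 0 := by
  have key : ∀ m ≤ n, edgeBoundary (pathChain c m) = Pi.single (c 0) 1 + Pi.single (c m) 1 := by
    intro m hm
    induction m with
    | zero => simp [pathChain, ZModModule.add_self]
    | succ m ih =>
      rw [pathChain, sum_range_succ, map_add, ← pathChain, ih (by omega),
        edgeBoundary_edgeChain (h.adj m hm).1, ZModModule.add_add_add_cancel]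
  rw [key n le_rfl, h.closed, ZModModule.add_self]

lemma IsClosedPath.exists_triangleBoundary_eq (hD : IsDisc D) (h : IsClosedPath D n c) :
    ∃ C ⊆ triangleFinset D, triangleBoundary C = pathChain c n := by
  refine hD.simplyConnected.mem_boundaries (fun e he => ?_) h.edgeBoundary_pathChain
  obtain ⟨i, hi, rfl⟩ := mem_pathEdges.1 (not_imp_comm.1 pathChain_eq_zero he)
  exact ⟨(h.adj i hi).2, card_pair (h.adj i hi).1⟩

/-- A simple closed edge path of length `n` together with a set `C` of triangles filling it. -/
structure IsFilledPolygon (D : AbstractSimplicialComplex W) (n : ℕ) (c : ℕ → W)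
    (C : Finset (Finset W)) : Prop extends IsClosedPath D n c where
  three_le : 3 ≤ n
  injOn : Set.InjOn c (Set.Iio n)
  subset : C ⊆ triangleFinset D
  triangleBoundary_eq : triangleBoundary C = pathChain c n

namespace IsFilledPolygon

lemma eq_cases (h : IsFilledPolygon D n c C) {a b : ℕ} (ha : a ≤ n) (hb : b ≤ n)
    (hab : c a = c b) : a = b ∨ a = 0 ∧ b = n ∨ a = n ∧ b = 0 := by
  have h0 : 0 < n := by have := h.three_le; omega
  rcases ha.eq_or_lt with rfl | ha <;> rcases hb.eq_or_lt with rfl | hb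
  · exact .inl rfl
  · exact .inr (.inr ⟨rfl, (h.injOn h0 hb (h.closed ▸ hab)).symm⟩)
  · exact .inr (.inl ⟨h.injOn ha h0 (h.closed ▸ hab), rfl⟩)
  · exact .inl (h.injOn ha hb hab)

lemma ne_add_two (h : IsFilledPolygon D n c C) {i : ℕ} (hi : i + 1 < n) : c i ≠ c (i + 2) := by
  intro e
  have := h.three_le
  have := h.eq_cases (by omega) hi e
  omega

lemma eq_or_eq_of_mem (h : IsFilledPolygon D n c C) {i k : ℕ} (hi : i + 1 < n) (hk : k < n)
    (hmem : c (i + 1) ∈ ({c k, c (k + 1)} : Finset W)) : k = i ∨ k = i + 1 := by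
  rw [mem_insert, mem_singleton] at hmem
  rcases hmem with e | e
  · have := h.eq_cases hi.le hk.le e
    omega
  · have := h.eq_cases hi.le hk e
    omega

lemma pair_injOn (h : IsFilledPolygon D n c C) :
    Set.InjOn (fun i => ({c i, c (i + 1)} : Finset W)) (Set.Iio n) := by
  intro i (hi : i < n) k (hk : k < n) (e : {c i, c (i + 1)} = {c k, c (k + 1)})
  have := h.three_le
  have h1 : c i ∈ ({c k, c (k + 1)} : Finset W) := e ▸ mem_insert_self _ _
  have h2 : c (i + 1) ∈ ({c k, c (k + 1)} : Finset W) :=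
    e ▸ mem_insert_of_mem (mem_singleton_self _)
  rw [mem_insert, mem_singleton] at h1 h2
  rcases h1 with h1 | h1
  · exact h.injOn hi hk h1
  have := h.eq_cases hi.le hk h1
  rcases h2 with h2 | h2
  · have := h.eq_cases hi hk.le h2
    omega
  · have := h.eq_cases hi hk h2
    omega

lemma mem_image_of_mem_pathEdges (h : IsFilledPolygon D n c C) {e : Finset W} {x : W}
    (he : e ∈ pathEdges c n) (hx : x ∈ e) : x ∈ (range n).image c := by
  obtain ⟨i, hi, rfl⟩ := mem_pathEdges.1 he
  rw [mem_insert, mem_singleton] at hx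
  rcases hx with rfl | rfl
  · exact mem_image_of_mem c (mem_range.2 hi)
  rcases Nat.lt_or_ge (i + 1) n with hi1 | hi1
  · exact mem_image_of_mem c (mem_range.2 hi1)
  · rw [show i + 1 = n by omega, h.closed]
    exact mem_image_of_mem c (mem_range.2 (by omega))

lemma triangleBoundary_pair_succ (h : IsFilledPolygon D n c C) {i : ℕ} (hi : i < n) :
    triangleBoundary C {c i, c (i + 1)} = 1 := by
  rw [h.triangleBoundary_eq, pathChain, Finset.sum_apply, sum_eq_single i, edgeChain,
    Pi.single_eq_same]
  · exact fun k hk hki => Pi.single_eq_of_ne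
      (fun e => hki (h.pair_injOn (mem_range.1 hk) hi e.symm)) _
  · simp [hi]

lemma triangleBoundary_eq_zero (h : IsFilledPolygon D n c C) {e : Finset W}
    (he : e ∉ pathEdges c n) : triangleBoundary C e = 0 := by
  rw [h.triangleBoundary_eq, pathChain_eq_zero he]

lemma card_edgeStar_succ (hD : IsDisc D) (h : IsFilledPolygon D n c C) {i : ℕ} (hi : i < n) :
    #(edgeStar C (c i) (c (i + 1))) = 1 := by
  have hne := (h.adj i hi).1
  have hodd := h.triangleBoundary_pair_succ hi
  rw [triangleBoundary_pair C hne, ZMod.natCast_eq_one_iff_odd] at hodd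
  have hle := (card_le_card (edgeStar_mono h.subset (c i) (c (i + 1)))).trans
    (hD.card_edgeStar_le_two hne)
  obtain ⟨k, hk⟩ := hodd
  omega

lemma exists_triangle (hD : IsDisc D) (h : IsFilledPolygon D n c C) {i : ℕ} (hi : i < n) :
    ∃ σ ∈ C, c i ∈ σ ∧ c (i + 1) ∈ σ := by
  obtain ⟨σ, hσ⟩ := card_pos.1 ((h.card_edgeStar_succ hD hi).symm ▸ one_pos)
  exact ⟨σ, mem_edgeStar.1 hσ⟩

lemma card_vertexStar_pos (hD : IsDisc D) (h : IsFilledPolygon D n c C) {i : ℕ} (hi : i < n) :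
    0 < #(vertexStar C (c i)) := by
  obtain ⟨σ, hσ, hmem, -⟩ := h.exists_triangle hD hi
  exact card_pos.2 ⟨σ, mem_vertexStar.2 ⟨hσ, hmem⟩⟩

end IsFilledPolygon

end Polygon

section GaussBonnet

variable {W : Type*} [Fintype W] {D : AbstractSimplicialComplex W} {n : ℕ} {c : ℕ → W}
  {C : Finset (Finset W)}

namespace IsFilledPolygon

lemma edgeBoundary_succ (h : IsFilledPolygon D n c C) {z : Finset W → ZMod 2}
    (hz : ∀ e, e ∉ pathEdges c n → z e = 0) {i : ℕ} (hi : i + 1 < n) :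
    edgeBoundary z (c (i + 1)) = z {c i, c (i + 1)} + z {c (i + 1), c (i + 2)} := by
  have hne : ({c i, c (i + 1)} : Finset W) ≠ {c (i + 1), c (i + 2)} := fun e => by
    have := h.pair_injOn (show i < n by omega) hi e
    omega
  rw [edgeBoundary_apply, ← sum_pair hne]
  refine (sum_subset (fun e he => ?_) fun e he hoff => hz e fun hmem => hoff ?_).symm
  · rw [mem_insert, mem_singleton] at he
    rcases he with rfl | rfl <;> simp
  · obtain ⟨k, hk, rfl⟩ := mem_pathEdges.1 hmem
    rcases h.eq_or_eq_of_mem hi hk (mem_filter.1 he).2 with rfl | rfl <;> simp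

lemma eq_zero_or_eq_triangleBoundary (h : IsFilledPolygon D n c C) {z : Finset W → ZMod 2}
    (hz : ∀ e, e ∉ pathEdges c n → z e = 0) (hcycle : edgeBoundary z = 0) :
    z = 0 ∨ z = triangleBoundary C := by
  have const : ∀ i < n, z {c i, c (i + 1)} = z {c 0, c 1} := by
    intro i hi
    induction i with
    | zero => rfl
    | succ i ih =>
      have := h.edgeBoundary_succ hz hi
      rw [hcycle, Pi.zero_apply, ih (by omega), eq_comm, CharTwo.add_eq_zero] at this
      exact this.symm
  have cases_mod_two : ∀ a : ZMod 2, a = 0 ∨ a = 1 := by decide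
  refine (cases_mod_two (z {c 0, c 1})).imp (fun h0 => ?_) fun h1 => ?_ <;> ext e <;>
    by_cases he : e ∈ pathEdges c n
  · obtain ⟨i, hi, rfl⟩ := mem_pathEdges.1 he
    rw [const i hi, h0, Pi.zero_apply]
  · exact hz e he
  · obtain ⟨i, hi, rfl⟩ := mem_pathEdges.1 he
    rw [const i hi, h1, h.triangleBoundary_pair_succ hi]
  · rw [hz e he, h.triangleBoundary_eq_zero he]

lemma nonempty (hD : IsDisc D) (h : IsFilledPolygon D n c C) : C.Nonempty := by
  obtain ⟨σ, hσ, -⟩ := h.exists_triangle hD (i := 0) (by have := h.three_le; omega)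
  exact ⟨σ, hσ⟩

lemma triangleBoundary_sdiff_eq_zero (hD : IsDisc D) (h : IsFilledPolygon D n c C)
    {C₀ : Finset (Finset W)} (hC₀ : C₀ ⊆ triangleFinset D)
    (hsupp : ∀ e, triangleBoundary C₀ e ≠ 0 → e ∈ edges C) {e : Finset W}
    (he : e ∉ pathEdges c n) : triangleBoundary (C₀ \ C) e = 0 := by
  by_cases h2 : #e = 2
  swap
  · rw [triangleBoundary_apply, if_neg h2]
  obtain ⟨x, y, hxy, rfl⟩ := card_eq_two.1 h2
  by_cases hne : (edgeStar C x y).Nonempty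
  · have full := (hD.edgeStar_of_triangleBoundary_eq_zero h.subset hxy
      (h.triangleBoundary_eq_zero he) hne).1
    have : edgeStar (C₀ \ C) x y = ∅ := by
      refine eq_empty_of_forall_notMem fun τ hτ => ?_
      have hτC : τ ∈ edgeStar C x y := full ▸ edgeStar_mono (sdiff_subset.trans hC₀) x y hτ
      exact (mem_sdiff.1 (mem_edgeStar.1 hτ).1).2 (mem_edgeStar.1 hτC).1
    rw [triangleBoundary_pair _ hxy, this, card_empty, Nat.cast_zero]
  · have h0 := not_imp_comm.1 (hsupp {x, y}) ((pair_mem_edges hxy).not.2 hne)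
    have : edgeStar (C₀ \ C) x y = edgeStar C₀ x y := by
      ext τ
      simp only [mem_edgeStar, mem_sdiff]
      exact ⟨fun hτ => ⟨hτ.1.1, hτ.2⟩,
        fun hτ => ⟨⟨hτ.1, fun hτC => hne ⟨τ, mem_edgeStar.2 ⟨hτC, hτ.2⟩⟩⟩, hτ.2⟩⟩
    rw [triangleBoundary_pair _ hxy, this, ← triangleBoundary_pair _ hxy, h0]

lemma exists_subset_triangleBoundary_eq (hD : IsDisc D) (h : IsFilledPolygon D n c C)
    {z : Finset W → ZMod 2} (hz : ∀ e, z e ≠ 0 → e ∈ edges C) (hcycle : edgeBoundary z = 0) :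
    ∃ C' ⊆ C, triangleBoundary C' = z := by
  obtain ⟨C₀, hC₀, rfl⟩ := hD.simplyConnected.mem_boundaries (fun e he => by
    obtain ⟨h2, τ, hτ, hsub⟩ := mem_edges.1 (hz e he)
    exact ⟨mem_faces_of_subset (mem_triangleFinset.1 (h.subset hτ)).1 hsub
      (card_pos.1 (by omega)), h2⟩) hcycle
  refine ⟨C₀, ?_, rfl⟩
  have rest_subset : C₀ \ C ⊆ triangleFinset D := sdiff_subset.trans hC₀
  have rest_cycle : edgeBoundary (triangleBoundary (C₀ \ C)) = 0 :=
    edgeBoundary_triangleBoundary fun τ hτ => (mem_triangleFinset.1 (rest_subset hτ)).2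
  rcases h.eq_zero_or_eq_triangleBoundary
    (fun e => h.triangleBoundary_sdiff_eq_zero hD hC₀ hz) rest_cycle with h0 | heq
  · exact sdiff_eq_empty_iff_subset.1 (hD.eq_empty_of_triangleBoundary_eq_zero rest_subset h0)
  · have symmDiff_empty : symmDiff (C₀ \ C) C = ∅ :=
      hD.eq_empty_of_triangleBoundary_eq_zero
        (symmDiff_le_sup.trans (union_subset rest_subset h.subset))
        (by rw [triangleBoundary_symmDiff, heq, ZModModule.add_self])
    obtain ⟨σ, hσ⟩ := h.nonempty hD
    have hσ' : σ ∈ C₀ \ C := (symmDiff_eq_bot.1 symmDiff_empty).symm ▸ hσ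
    exact absurd hσ (mem_sdiff.1 hσ').2

lemma three_mul_card_add (hD : IsDisc D) (h : IsFilledPolygon D n c C) :
    3 * #C + n = 2 * #(edges C) := by
  have card_pathEdges : #(pathEdges c n) = n := by
    rw [pathEdges, card_image_of_injOn (by simpa using h.pair_injOn), card_range]
  have pathEdges_subset : pathEdges c n ⊆ edges C := by
    intro e he
    obtain ⟨i, hi, rfl⟩ := mem_pathEdges.1 he
    exact (pair_mem_edges (h.adj i hi).1).2
      (card_pos.1 ((h.card_edgeStar_succ hD hi).symm ▸ one_pos))
  have sum_on : ∑ e ∈ pathEdges c n, #{τ ∈ C | e ⊆ τ} = #(pathEdges c n) * 1 := by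
    refine sum_const_nat fun e he => ?_
    obtain ⟨i, hi, rfl⟩ := mem_pathEdges.1 he
    rw [← edgeStar_eq_filter_subset, h.card_edgeStar_succ hD hi]
  have sum_off : ∑ e ∈ edges C \ pathEdges c n, #{τ ∈ C | e ⊆ τ} =
      #(edges C \ pathEdges c n) * 2 := by
    refine sum_const_nat fun e he => ?_
    obtain ⟨heC, hoff⟩ := mem_sdiff.1 he
    obtain ⟨x, y, hxy, rfl⟩ := card_eq_two.1 (mem_edges.1 heC).1
    obtain ⟨heq, h2⟩ := hD.edgeStar_of_triangleBoundary_eq_zero h.subset hxy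
      (h.triangleBoundary_eq_zero hoff) ((pair_mem_edges hxy).1 heC)
    rw [← edgeStar_eq_filter_subset, heq, h2]
  have := card_le_card pathEdges_subset
  rw [← sum_card_filter_subset fun τ hτ => (mem_triangleFinset.1 (h.subset hτ)).2,
    ← sum_sdiff pathEdges_subset, sum_on, sum_off, card_sdiff_of_subset pathEdges_subset,
    card_pathEdges]
  omega

lemma sum_card_vertexStar_add_le (hD : IsDisc D)
    (hdeg : ∀ x, IsInteriorVertex D x → 6 ≤ ((skeleton D).neighborSet x).ncard)
    (h : IsFilledPolygon D n c C) :
    ∑ i ∈ range n, #(vertexStar C (c i)) + 6 * #(verts C) ≤ 3 * #C + 6 * n := by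
  have injOn_range : Set.InjOn c (range n) := by simpa using h.injOn
  have image_subset : (range n).image c ⊆ verts C := by
    intro x hx
    obtain ⟨i, hi, rfl⟩ := mem_image.1 hx
    obtain ⟨σ, hσ, hmem, -⟩ := h.exists_triangle hD (mem_range.1 hi)
    exact mem_verts.2 ⟨σ, hσ, hmem⟩
  have six_le : ∀ x ∈ verts C \ (range n).image c, 6 ≤ #(vertexStar C x) := by
    intro x hx
    obtain ⟨hxC, hoff⟩ := mem_sdiff.1 hx
    obtain ⟨σ, hσ, hxσ⟩ := mem_verts.1 hxC
    obtain ⟨hsub, hint⟩ := hD.vertexStar_of_triangleBoundary_eq_zero h.subset (x := x)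
      (fun y _ => h.triangleBoundary_eq_zero fun he =>
        hoff (h.mem_image_of_mem_pathEdges he (mem_insert_self x {y})))
      ⟨σ, mem_vertexStar.2 ⟨hσ, hxσ⟩⟩
    refine (hdeg x hint).trans ((hD.card_vertexStar_of_interior hint).symm.le.trans
      (card_le_card fun τ hτ => mem_vertexStar.2 ⟨hsub hτ, (mem_vertexStar.1 hτ).2⟩))
  have card_image_le := card_le_card image_subset
  have sum_off := card_nsmul_le_sum _ _ 6 six_le
  rw [smul_eq_mul, card_sdiff_of_subset image_subset, card_image_of_injOn injOn_range,
    card_range] at sum_off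
  rw [card_image_of_injOn injOn_range, card_range] at card_image_le
  rw [← sum_card_vertexStar fun τ hτ => (mem_triangleFinset.1 (h.subset hτ)).2,
    ← sum_sdiff image_subset, sum_image injOn_range]
  omega

theorem gaussBonnet (hD : IsDisc D)
    (hdeg : ∀ x, IsInteriorVertex D x → 6 ≤ ((skeleton D).neighborSet x).ncard)
    (h : IsFilledPolygon D n c C) :
    ∑ i ∈ range n, #(vertexStar C (c i)) + 6 ≤ 3 * n := by
  obtain ⟨σ, hσ, hmem, -⟩ := h.exists_triangle hD (i := 0) (by have := h.three_le; omega)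
  have euler := card_edges_lt ⟨c 0, mem_verts.2 ⟨σ, hσ, hmem⟩⟩
    fun z hz hcycle => h.exists_subset_triangleBoundary_eq hD hz hcycle
  have := h.three_mul_card_add hD
  have := h.sum_card_vertexStar_add_le hD hdeg
  omega

end IsFilledPolygon

end GaussBonnet

section Taut

variable {W : Type*} [Fintype W] {D : AbstractSimplicialComplex W} {n : ℕ} {c : ℕ → W}
  {C : Finset (Finset W)}

namespace IsFilledPolygon

lemma triangle_mem_of_card_vertexStar_eq_one (hD : IsDisc D) (h : IsFilledPolygon D n c C) {i : ℕ}
    (hi : i + 1 < n) (h1 : #(vertexStar C (c (i + 1))) = 1) :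
    {c i, c (i + 1), c (i + 2)} ∈ C := by
  obtain ⟨σ, hσ, h0, hσ1⟩ := h.exists_triangle hD (i := i) (by omega)
  obtain ⟨σ', hσ', hσ1', h2⟩ := h.exists_triangle hD hi
  obtain rfl : σ = σ' := card_le_one.1 h1.le _ (mem_vertexStar.2 ⟨hσ, hσ1⟩) _
    (mem_vertexStar.2 ⟨hσ', hσ1'⟩)
  convert hσ
  refine eq_of_subset_of_card_le (by simp [insert_subset_iff, h0, hσ1, h2]) ?_
  rw [(mem_triangleFinset.1 (h.subset hσ)).2, card_triple_eq_three_iff.2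
    ⟨(h.adj i (by omega)).1, h.ne_add_two hi, (h.adj (i + 1) hi).1⟩]

lemma exists_triangles_of_card_vertexStar_eq_two (hD : IsDisc D) (h : IsFilledPolygon D n c C)
    {i : ℕ} (hi : i + 1 < n) (h2 : #(vertexStar C (c (i + 1))) = 2)
    (hn : {c i, c (i + 1), c (i + 2)} ∉ C) :
    ∃ w, {c i, c (i + 1), w} ∈ C ∧ {c (i + 1), c (i + 2), w} ∈ C := by
  obtain ⟨σ, hσ, h0, hσ1⟩ := h.exists_triangle hD (i := i) (by omega)
  obtain ⟨σ', hσ', hσ1', hσ2'⟩ := h.exists_triangle hD hi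
  obtain ⟨w, hwi, hwi1, rfl⟩ :=
    exists_eq_triple (mem_triangleFinset.1 (h.subset hσ)).2 h0 hσ1 (h.adj i (by omega)).1
  have hw2 : c (i + 2) ≠ w := by
    rintro rfl
    exact hn hσ
  have hoff : {c (i + 1), w} ∉ pathEdges c n := by
    intro hmem
    obtain ⟨k, hk, e⟩ := mem_pathEdges.1 hmem
    have hw : w ∈ ({c k, c (k + 1)} : Finset W) := e ▸ mem_insert_of_mem (mem_singleton_self _)
    rcases h.eq_or_eq_of_mem hi hk (e ▸ mem_insert_self _ _) with rfl | rfl <;>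
      simp only [mem_insert, mem_singleton] at hw <;> grind
  obtain ⟨hstar, hcard⟩ := hD.edgeStar_of_triangleBoundary_eq_zero h.subset hwi1
    (h.triangleBoundary_eq_zero hoff) ⟨_, mem_edgeStar.2 ⟨hσ, by simp⟩⟩
  have edgeStar_eq : edgeStar C (c (i + 1)) w = vertexStar C (c (i + 1)) := by
    refine eq_of_subset_of_card_le (fun τ hτ => ?_) (by rw [hstar, hcard, h2])
    rw [mem_edgeStar] at hτ
    exact mem_vertexStar.2 ⟨hτ.1, hτ.2.1⟩
  have hw : w ∈ σ' := (mem_edgeStar.1 (edgeStar_eq ▸ mem_vertexStar.2 ⟨hσ', hσ1'⟩)).2.2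
  refine ⟨w, hσ, ?_⟩
  convert hσ'
  refine eq_of_subset_of_card_le (by simp [insert_subset_iff, hσ1', hσ2', hw]) ?_
  rw [(mem_triangleFinset.1 (h.subset hσ')).2,
    card_triple_eq_three_iff.2 ⟨(h.adj (i + 1) hi).1, hwi1, hw2⟩]

lemma two_le_card_vertexStar (hD : IsDisc D) (h : IsFilledPolygon D n c C) {i : ℕ}
    (hi : i + 1 < n) (hna : ¬ (skeleton D).Adj (c i) (c (i + 2))) :
    2 ≤ #(vertexStar C (c (i + 1))) := by
  have hpos := h.card_vertexStar_pos hD hi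
  have hne_one : #(vertexStar C (c (i + 1))) ≠ 1 := fun h1 => hna <| adj_of_mem_triangleFinset
    (h.subset (h.triangle_mem_of_card_vertexStar_eq_one hD hi h1)) (by simp) (by simp)
    (h.ne_add_two hi)
  omega

end IsFilledPolygon

omit [Fintype W] in
lemma IsClosedPath.update (h : IsClosedPath D n c) {i : ℕ} (hi : i + 1 < n) {w : W}
    (h1 : (skeleton D).Adj (c i) w) (h2 : (skeleton D).Adj w (c (i + 2))) :
    IsClosedPath D n (Function.update c (i + 1) w) := by
  have update_ne {k : ℕ} (hk : k ≠ i + 1) : Function.update c (i + 1) w k = c k :=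
    Function.update_of_ne hk ..
  refine ⟨by rw [update_ne (by omega), update_ne (by omega), h.closed], fun k hk => ?_⟩
  by_cases hk1 : k = i
  · subst hk1
    rwa [Function.update_self, update_ne (by omega)]
  by_cases hk2 : k = i + 1
  · subst hk2
    rwa [Function.update_self, update_ne (by omega)]
  · rw [update_ne hk2, update_ne (by omega)]
    exact h.adj k hk

/-- A vertex of the polygon with at most two triangles can be pushed across them. -/
lemma IsFilledPolygon.exists_update_lt (hD : IsDisc D) (h : IsFilledPolygon D n c C) {i : ℕ}
    (hi : i + 1 < n) (hna : ¬ (skeleton D).Adj (c i) (c (i + 2)))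
    (hcard : #(vertexStar C (c (i + 1))) < 3) :
    ∃ w, ∃ C' ⊆ triangleFinset D, #C' < #C ∧ IsClosedPath D n (Function.update c (i + 1) w) ∧
      triangleBoundary C' = pathChain (Function.update c (i + 1) w) n := by
  have hne := h.ne_add_two hi
  have hnC : {c i, c (i + 1), c (i + 2)} ∉ C := fun hmem =>
    hna (adj_of_mem_triangleFinset (h.subset hmem) (by simp) (by simp) hne)
  have htwo := h.two_le_card_vertexStar hD hi hna
  obtain ⟨w, hσ, hτ⟩ := h.exists_triangles_of_card_vertexStar_eq_two hD hi (by omega) hnC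
  obtain ⟨h01, h0w, h1w⟩ := ne_of_triple_mem_triangleFinset (h.subset hσ)
  obtain ⟨h12, -, h2w⟩ := ne_of_triple_mem_triangleFinset (h.subset hτ)
  have path := h.toIsClosedPath.update hi
    (adj_of_mem_triangleFinset (h.subset hσ) (by simp) (by simp) h0w)
    (adj_of_mem_triangleFinset (h.subset hτ) (by simp) (by simp) h2w.symm)
  have triangles_ne : ({c i, c (i + 1), w} : Finset W) ∉
      ({{c (i + 1), c (i + 2), w}} : Finset (Finset W)) := by
    intro e
    have : c i ∈ ({c (i + 1), c (i + 2), w} : Finset W) :=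
      mem_singleton.1 e ▸ mem_insert_self _ _
    simp [h01, hne, h0w] at this
  have pair_subset : {{c i, c (i + 1), w}, {c (i + 1), c (i + 2), w}} ⊆ C := by
    simp [insert_subset_iff, hσ, hτ]
  refine ⟨w, C \ {{c i, c (i + 1), w}, {c (i + 1), c (i + 2), w}},
    sdiff_subset.trans h.subset, card_lt_card (sdiff_ssubset pair_subset (by simp)), path, ?_⟩
  have boundary_split := sum_sdiff (f := fun τ => triangleBoundary {τ}) pair_subset
  rw [sum_insert triangles_ne, sum_singleton, ← triangleBoundary_eq_sum,
    ← triangleBoundary_eq_sum, h.triangleBoundary_eq, triangleBoundary_triple h01 h0w h1w,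
    triangleBoundary_triple h12 h1w h2w, edgeChain_comm (c (i + 2))] at boundary_split
  rw [pathChain_update c w hi]
  linear_combination boundary_split -
    ZModModule.add_self (edgeChain (c i) (c (i + 1)) + edgeChain (c (i + 1)) w +
      edgeChain (c i) w + edgeChain (c (i + 1)) (c (i + 2)) + edgeChain w (c (i + 2)))

/-- Minimize the number of triangles over all fillings of the closed paths that agree with `c₀` away
from `I`. -/
lemma exists_isFilledPolygon_three_le_card (hD : IsDisc D) (hn : 3 ≤ n)
    {c₀ : ℕ → W} (h₀ : IsClosedPath D n c₀) {I : Set ℕ} (hI : I ⊆ Set.Ioo 0 n)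
    (hinj : ∀ c, IsClosedPath D n c → Set.EqOn c c₀ Iᶜ → Set.InjOn c (Set.Iio n))
    (hnadj : ∀ c, IsClosedPath D n c → Set.EqOn c c₀ Iᶜ →
      ∀ i, i + 1 ∈ I → ¬ (skeleton D).Adj (c i) (c (i + 2))) :
    ∃ c C, IsFilledPolygon D n c C ∧ Set.EqOn c c₀ Iᶜ ∧ ∀ i ∈ I, 3 ≤ #(vertexStar C (c i)) := by
  let Q (N : ℕ) : Prop := ∃ c C, IsFilledPolygon D n c C ∧ Set.EqOn c c₀ Iᶜ ∧ #C = N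
  have hQ : ∃ N, Q N := by
    obtain ⟨C, hC, hbd⟩ := h₀.exists_triangleBoundary_eq hD
    exact ⟨#C, c₀, C, ⟨h₀, hn, hinj c₀ h₀ fun _ _ => rfl, hC, hbd⟩, fun _ _ => rfl, rfl⟩
  obtain ⟨c, C, hc, hfix, hcard⟩ := Nat.find_spec hQ
  refine ⟨c, C, hc, hfix, fun i hi => ?_⟩
  obtain ⟨hpos, hlt⟩ := hI hi
  obtain ⟨i, rfl⟩ := Nat.exists_eq_add_of_le' hpos
  by_contra! hlt3
  obtain ⟨w, C', hC', hcard', path, hbd⟩ :=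
    hc.exists_update_lt hD hlt (hnadj c hc.toIsClosedPath hfix i hi) hlt3
  have hfix' : Set.EqOn (Function.update c (i + 1) w) c₀ Iᶜ := fun k hk => by
    rw [Function.update_of_ne (by rintro rfl; exact hk hi), hfix hk]
  exact Nat.find_min hQ (hcard ▸ hcard')
    ⟨_, C', ⟨path, hn, hinj _ path hfix', hC', hbd⟩, hfix', rfl⟩

end Taut

section Geodesic

variable {W : Type*} {D : AbstractSimplicialComplex W}

lemma dist_le_dist_add_one (hD : (skeleton D).Connected) {v x y : W}
    (h : (skeleton D).Adj x y) : (skeleton D).dist v y ≤ (skeleton D).dist v x + 1 := by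
  simpa only [SimpleGraph.dist_eq_one_iff_adj.2 h] using hD.dist_triangle (u := v) (v := x) (w := y)

lemma exists_lower (hD : (skeleton D).Connected) {v x : W} {k : ℕ}
    (hx : (skeleton D).dist v x = k + 1) :
    ∃ z, (skeleton D).Adj x z ∧ (skeleton D).dist v z = k := by
  obtain ⟨p, hp⟩ := hD.exists_walk_length_eq_dist x v
  rw [SimpleGraph.dist_comm, hx] at hp
  have hnil : ¬ p.Nil := by
    rw [SimpleGraph.Walk.not_nil_iff_lt_length]
    omega
  have hadj := p.adj_snd hnil
  refine ⟨p.snd, hadj, le_antisymm ?_ ?_⟩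
  · have := SimpleGraph.dist_le p.tail
    rw [SimpleGraph.dist_comm]
    have := p.length_tail_add_one hnil
    omega
  · have := dist_le_dist_add_one hD (v := v) hadj.symm
    omega

lemma IsClosedPath.dist_le (hD : (skeleton D).Connected) {n : ℕ} {c : ℕ → W}
    (h : IsClosedPath D n c) {k l : ℕ} (hkl : k + l ≤ n) :
    (skeleton D).dist (c k) (c (k + l)) ≤ l := by
  induction l with
  | zero => simp
  | succ l ih => exact (dist_le_dist_add_one hD (h.adj _ hkl)).trans (by grind)

lemma isClosedPath_getVert {z : W} (w : (skeleton D).Walk z z) :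
    IsClosedPath D w.length w.getVert :=
  ⟨by simp, fun _ hi => w.adj_getVert_succ hi⟩

/-- A path outside the ball of radius `k` about `v`, joining two vertices at distance `k`. -/
structure IsOuterPath {a b : W} (v : W) (k : ℕ) (r : (skeleton D).Walk a b) : Prop where
  isPath : r.IsPath
  ne : a ≠ b
  dist_left : (skeleton D).dist v a = k
  dist_right : (skeleton D).dist v b = k
  lt_dist : ∀ i, 0 < i → i < r.length → k < (skeleton D).dist v (r.getVert i)

/-- A closed path that consists of a geodesic from the apex `c 0` to `a`, the outer path `r` from
`a` to `b`, and a geodesic back from `b` to the apex. Both geodesics have length `m`, point away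
from `v` and meet only in the apex, by the choice of `m`. -/
structure IsBigon {a b : W} (v : W) (k : ℕ) (r : (skeleton D).Walk a b) (m : ℕ) (c : ℕ → W) : Prop
    extends IsClosedPath D (2 * m + r.length) c where
  dist_apex : (skeleton D).dist v (c 0) + m = k
  apply_add : ∀ i ≤ r.length, c (m + i) = r.getVert i
  minimal : ∀ i < m, ∀ z, (skeleton D).dist v z + i = k →
    (skeleton D).dist z a ≤ i → ¬ (skeleton D).dist z b ≤ i

variable {a b v : W} {k m : ℕ} {r : (skeleton D).Walk a b} {c : ℕ → W}

lemma IsOuterPath.exists_isBigon (hD : (skeleton D).Connected) (hr : IsOuterPath v k r) :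
    ∃ m c, 0 < m ∧ IsBigon v k r m c := by
  let Q (m : ℕ) : Prop := ∃ z, (skeleton D).dist v z + m = k ∧
    (skeleton D).dist z a ≤ m ∧ (skeleton D).dist z b ≤ m
  have hQ : ∃ m, Q m := ⟨k, v, by simp, hr.dist_left.le, hr.dist_right.le⟩
  obtain ⟨z, hz, hza, hzb⟩ := Nat.find_spec hQ
  have hmin (i : ℕ) (hi : i < Nat.find hQ) : ¬ Q i := Nat.find_min hQ hi
  generalize Nat.find hQ = m at hz hza hzb hmin
  have dist_a := hD.dist_triangle (u := v) (v := z) (w := a)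
  have dist_b := hD.dist_triangle (u := v) (v := z) (w := b)
  rw [hr.dist_left] at dist_a
  rw [hr.dist_right] at dist_b
  obtain ⟨p, hp⟩ := hD.exists_walk_length_eq_dist z a
  obtain ⟨q, hq⟩ := hD.exists_walk_length_eq_dist b z
  rw [SimpleGraph.dist_comm] at hq
  have hlen : (p.append (r.append q)).length = 2 * m + r.length := by
    simp only [SimpleGraph.Walk.length_append]
    omega
  refine ⟨m, (p.append (r.append q)).getVert, Nat.pos_of_ne_zero ?_,
    ⟨hlen ▸ isClosedPath_getVert _, by simpa using hz, fun i hi => ?_,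
      fun i hi z h1 h2 h3 => hmin i hi ⟨z, h1, h2, h3⟩⟩⟩
  · rintro rfl
    rw [Nat.le_zero, hD.dist_eq_zero_iff] at hza hzb
    exact hr.ne (hza.symm.trans hzb)
  · have hpm : p.length = m := by omega
    rw [SimpleGraph.Walk.getVert_append, SimpleGraph.Walk.getVert_append, hpm,
      if_neg (by omega), Nat.add_sub_cancel_left]
    split_ifs with hlt
    · rfl
    · rw [hi.antisymm (not_lt.1 hlt), Nat.sub_self, q.getVert_zero, r.getVert_length]

namespace IsBigon

lemma apply_left (h : IsBigon v k r m c) : c m = a := by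
  simpa using h.apply_add 0

lemma apply_right (h : IsBigon v k r m c) : c (m + r.length) = b := by
  simpa using h.apply_add r.length

lemma dist_up (hD : (skeleton D).Connected) (hr : IsOuterPath v k r) (h : IsBigon v k r m c)
    {i : ℕ} (hi : i ≤ m) : (skeleton D).dist v (c i) + m = k + i := by
  obtain ⟨l, rfl⟩ := Nat.exists_eq_add_of_le hi
  have below := h.dist_le hD (k := 0) (l := i) (by omega)
  have above := h.dist_le hD (k := i) (l := l) (by omega)
  rw [h.apply_left] at above
  rw [zero_add] at below
  have := hD.dist_triangle (u := v) (v := c 0) (w := c i)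
  have := hD.dist_triangle (u := v) (v := c i) (w := a)
  have := h.dist_apex
  have := hr.dist_left
  omega

lemma dist_down (hD : (skeleton D).Connected) (hr : IsOuterPath v k r) (h : IsBigon v k r m c)
    {i : ℕ} (hi : i ≤ m) : (skeleton D).dist v (c (m + r.length + i)) + i = k := by
  obtain ⟨l, rfl⟩ := Nat.exists_eq_add_of_le hi
  have above := h.dist_le hD (k := i + l + r.length) (l := i) (by omega)
  have below := h.dist_le hD (k := i + l + r.length + i) (l := l) (by omega)
  rw [h.apply_right, SimpleGraph.dist_comm] at above
  rw [show i + l + r.length + i + l = 2 * (i + l) + r.length by ring, h.closed,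
    SimpleGraph.dist_comm] at below
  have := hD.dist_triangle (u := v) (v := c 0) (w := c (i + l + r.length + i))
  have := hD.dist_triangle (u := v) (v := c (i + l + r.length + i)) (w := b)
  have := h.dist_apex
  have := hr.dist_right
  omega

lemma apply_ne_of_le (hD : (skeleton D).Connected) (hr : IsOuterPath v k r)
    (h : IsBigon v k r m c) {i j : ℕ} (hi : i ≤ m) (hj : j < m) :
    c i ≠ c (m + r.length + j) := fun e => by
  have hij : i + j = m := by
    have := h.dist_up hD hr hi
    have := h.dist_down hD hr hj.le
    rw [← e] at this
    omega
  have dist_a := h.dist_le hD (k := i) (l := j) (by omega)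
  have dist_b := h.dist_le hD (k := m + r.length) (l := j) (by omega)
  rw [hij, h.apply_left] at dist_a
  rw [h.apply_right, SimpleGraph.dist_comm] at dist_b
  exact h.minimal j hj _ (h.dist_down hD hr hj.le) (e ▸ dist_a) dist_b

lemma injOn (hD : (skeleton D).Connected) (hr : IsOuterPath v k r) (h : IsBigon v k r m c) :
    Set.InjOn c (Set.Iio (2 * m + r.length)) := by
  refine fun i hi l hl e => ?_
  wlog hil : i < l generalizing i l
  · rcases (not_lt.1 hil).lt_or_eq with h | h
    exacts [(this l hl i hi e.symm h).symm, h.symm]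
  have dist_eq := congrArg ((skeleton D).dist v) e
  have cases_of_lt {i : ℕ} (hi : i < 2 * m + r.length) :
      i ≤ m ∧ (skeleton D).dist v (c i) + m = k + i ∨
      (∃ j < r.length, i = m + j ∧ k < (skeleton D).dist v (c i)) ∨
      ∃ j < m, i = m + r.length + j ∧ (skeleton D).dist v (c i) + j = k := by
    rcases le_or_gt i m with him | him
    · exact .inl ⟨him, h.dist_up hD hr him⟩
    obtain ⟨j, rfl⟩ := Nat.exists_eq_add_of_le him.le
    rcases lt_or_ge j r.length with hj | hj
    · exact .inr (.inl ⟨j, hj, rfl, h.apply_add j hj.le ▸ hr.lt_dist j (by omega) hj⟩)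
    · obtain ⟨j, rfl⟩ := Nat.exists_eq_add_of_le hj
      rw [← add_assoc]
      exact .inr (.inr ⟨j, by omega, rfl, h.dist_down hD hr (by omega)⟩)
  rcases cases_of_lt hi with ⟨him, hdi⟩ | ⟨j, hj, rfl, hdi⟩ | ⟨j, _, rfl, hdi⟩ <;>
    rcases cases_of_lt hl with ⟨hlm, hdl⟩ | ⟨j', hj', rfl, hdl⟩ | ⟨j', hj', rfl, hdl⟩ <;>
    try omega
  · exact absurd e (h.apply_ne_of_le hD hr him hj')
  · rw [h.apply_add j hj.le, h.apply_add j' hj'.le] at e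
    rw [hr.isPath.getVert_injOn hj.le hj'.le e]

lemma not_adj (hD : (skeleton D).Connected) (hr : IsOuterPath v k r) (h : IsBigon v k r m c)
    {i : ℕ} (hi : i + 1 < m ∨ m + r.length ≤ i ∧ i + 2 ≤ 2 * m + r.length) :
    ¬ (skeleton D).Adj (c i) (c (i + 2)) := fun hadj => by
  have := dist_le_dist_add_one hD (v := v) hadj
  have := dist_le_dist_add_one hD (v := v) hadj.symm
  rcases hi with hi | ⟨hi, hi'⟩
  · have := h.dist_up hD hr (i := i) (by omega)
    have := h.dist_up hD hr (i := i + 2) (by omega)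
    omega
  · obtain ⟨j, rfl⟩ := Nat.exists_eq_add_of_le hi
    have := h.dist_down hD hr (i := j) (by omega)
    have := h.dist_down hD hr (i := j + 2) (by omega)
    grind

end IsBigon

lemma IsOuterPath.length_pos (hr : IsOuterPath v k r) : 0 < r.length :=
  Nat.pos_of_ne_zero (mt SimpleGraph.Walk.eq_of_length_eq_zero hr.ne)

variable [Fintype W] {C : Finset (Finset W)}

/-- A bigon with a filling that cannot be reduced along the two geodesics. -/
structure IsTautBigon (v : W) (k : ℕ) (r : (skeleton D).Walk a b) (m : ℕ) (c : ℕ → W)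
    (C : Finset (Finset W)) : Prop
    extends IsBigon v k r m c, IsFilledPolygon D (2 * m + r.length) c C where
  pos : 0 < m
  three_le_up : ∀ i, 0 < i → i < m → 3 ≤ #(vertexStar C (c i))
  three_le_down : ∀ i, 0 < i → i < m → 3 ≤ #(vertexStar C (c (m + r.length + i)))

lemma IsOuterPath.exists_isTautBigon (hD : IsDisc D) (hr : IsOuterPath v k r) :
    ∃ m c C, IsTautBigon v k r m c C := by
  have hconn := hD.simplyConnected.connected
  have hpos := hr.length_pos
  obtain ⟨m, c₀, hm, h₀⟩ := hr.exists_isBigon hconn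
  let I : Set ℕ := {i | 0 < i ∧ i < m ∨ m + r.length < i ∧ i < 2 * m + r.length}
  have bigon_of_eqOn (c : ℕ → W) (hc : IsClosedPath D (2 * m + r.length) c)
      (e : Set.EqOn c c₀ Iᶜ) : IsBigon v k r m c := by
    refine ⟨hc, ?_, fun i hi => ?_, h₀.minimal⟩
    · rw [e (by simp [I]), h₀.dist_apex]
    · rw [e (by simp [I]; omega), h₀.apply_add i hi]
  obtain ⟨c, C, hc, e, hI⟩ := exists_isFilledPolygon_three_le_card hD (by omega)
    h₀.toIsClosedPath (I := I)
    (fun i hi => by simp only [I, Set.mem_ofPred_eq] at hi; simp; omega)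
    (fun c hc e => (bigon_of_eqOn c hc e).injOn hconn hr)
    (fun c hc e i hi => (bigon_of_eqOn c hc e).not_adj hconn hr (by
      simp only [I, Set.mem_ofPred_eq] at hi
      omega))
  exact ⟨m, c, C, bigon_of_eqOn c hc.toIsClosedPath e, hc.three_le, hc.injOn, hc.subset,
    hc.triangleBoundary_eq, hm, fun i h0 h1 => hI i (.inl ⟨h0, h1⟩),
    fun i h0 h1 => hI _ (.inr ⟨by omega, by omega⟩)⟩

lemma IsTautBigon.sum_card_vertexStar_lt (hD : IsDisc D)
    (hdeg : ∀ x, IsInteriorVertex D x → 6 ≤ ((skeleton D).neighborSet x).ncard)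
    (h : IsTautBigon v k r m c C) :
    ∑ i ∈ range (r.length + 1), #(vertexStar C (c (m + i))) < 3 * r.length := by
  have gb := h.toIsFilledPolygon.gaussBonnet hD hdeg
  have apex := h.card_vertexStar_pos hD (i := 0) (by have := h.pos; omega)
  obtain ⟨l, rfl⟩ := Nat.exists_eq_add_one.2 h.pos
  have split : 2 * (l + 1) + r.length = (l + 1) + (r.length + 1) + l := by ring
  rw [split, sum_range_add, sum_range_add, sum_range_succ'] at gb
  have up : #(range l) • 3 ≤ ∑ i ∈ range l, #(vertexStar C (c (i + 1))) :=
    card_nsmul_le_sum _ _ _ fun i hi => h.three_le_up (i + 1) (by omega) (by simpa using hi)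
  have down : #(range l) • 3 ≤
      ∑ i ∈ range l, #(vertexStar C (c (l + 1 + (r.length + 1) + i))) := by
    refine card_nsmul_le_sum _ _ _ fun i hi => ?_
    rw [show l + 1 + (r.length + 1) + i = l + 1 + r.length + (i + 1) by ring]
    exact h.three_le_down (i + 1) (by omega) (by simpa using hi)
  simp only [card_range, smul_eq_mul] at up down
  omega

omit [Fintype W] in
theorem exists_common_lower (hD : IsDisc D)
    (hdeg : ∀ x, IsInteriorVertex D x → 6 ≤ ((skeleton D).neighborSet x).ncard)
    (ha : (skeleton D).dist v a = k + 1) (hb : (skeleton D).dist v b = k + 1)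
    (hab : (skeleton D).Adj a b) :
    ∃ z, (skeleton D).dist v z = k ∧ (skeleton D).Adj z a ∧ (skeleton D).Adj z b := by
  have := hD.finite
  cases nonempty_fintype W
  have hr : IsOuterPath v (k + 1) hab.toWalk :=
    ⟨hab.isPath_toWalk, hab.1, ha, hb, by simp; omega⟩
  obtain ⟨m, c, C, h⟩ := hr.exists_isTautBigon hD
  obtain ⟨l, rfl⟩ := Nat.exists_eq_add_one.2 h.pos
  have sum_lt := h.sum_card_vertexStar_lt hD hdeg
  have pos_b := h.card_vertexStar_pos hD (i := l + 1 + 1) (by simp)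
  have pos_a := h.card_vertexStar_pos hD (i := l + 1) (by simp)
  simp only [SimpleGraph.Walk.length_cons, SimpleGraph.Walk.length_nil, sum_range_succ] at sum_lt
  have hC := h.subset <| h.triangle_mem_of_card_vertexStar_eq_one hD (i := l) (by simp)
    (by simp at sum_lt; omega)
  have apply_b : c (l + 2) = b := by simpa using h.apply_right
  rw [h.apply_left, apply_b] at hC
  obtain ⟨ne_a, ne_b, -⟩ := ne_of_triple_mem_triangleFinset hC
  have := h.dist_up hD.simplyConnected.connected hr (i := l) (by omega)
  exact ⟨c l, by omega, adj_of_mem_triangleFinset hC (by simp) (by simp) ne_a,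
    adj_of_mem_triangleFinset hC (by simp) (by simp) ne_b⟩

theorem lower_triangle (hD : IsDisc D)
    (hdeg : ∀ x, IsInteriorVertex D x → 6 ≤ ((skeleton D).neighborSet x).ncard) {x : W}
    (hx : (skeleton D).dist v x = k + 1) (ha : (skeleton D).dist v a = k)
    (hb : (skeleton D).dist v b = k) (hab : a ≠ b) (hxa : (skeleton D).Adj x a)
    (hxb : (skeleton D).Adj x b) : {x, a, b} ∈ triangleFinset D := by
  have hconn := hD.simplyConnected.connected
  let r : (skeleton D).Walk a b := .cons hxa.symm hxb.toWalk
  have hr : IsOuterPath v k r := by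
    refine ⟨?_, hab, ha, hb, fun i h0 hi => ?_⟩
    · simpa [r, SimpleGraph.Walk.cons_isPath_iff, hab] using ⟨hxb.1, hxa.1.symm⟩
    · obtain rfl : i = 1 := by simp [r] at hi; omega
      simp [r, hx]
  obtain ⟨m, c, C, h⟩ := hr.exists_isTautBigon hD
  obtain ⟨l, rfl⟩ := Nat.exists_eq_add_one.2 h.pos
  have apply_x : c (l + 2) = x := by simpa [r] using h.apply_add 1 (by simp [r])
  have apply_b : c (l + 3) = b := by simpa [r] using h.apply_right
  have dist_pred := h.dist_up hconn hr (i := l) (by omega)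
  have dist_succ := h.dist_down hconn hr (i := 1) (by omega)
  have two_le_a : 2 ≤ #(vertexStar C (c (l + 1))) :=
    h.two_le_card_vertexStar hD (by simp [r]; omega) fun hadj => by
      have := dist_le_dist_add_one hconn (v := v) hadj
      rw [apply_x, hx] at this
      omega
  have two_le_b : 2 ≤ #(vertexStar C (c (l + 3))) :=
    h.two_le_card_vertexStar hD (i := l + 2) (by simp [r]; omega) fun hadj => by
      have := dist_le_dist_add_one hconn (v := v) hadj.symm
      rw [apply_x, hx] at this
      simp [r] at dist_succ
      grind
  have pos_x := h.card_vertexStar_pos hD (i := l + 2) (by simp [r]; omega)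
  have sum_lt := h.sum_card_vertexStar_lt hD hdeg
  simp [r, sum_range_succ] at sum_lt
  have hC := h.subset <| h.triangle_mem_of_card_vertexStar_eq_one hD (i := l + 1)
    (by simp [r]) (by grind)
  rwa [h.apply_left, apply_x, apply_b, insert_comm] at hC

theorem clique_triangle (hD : IsDisc D)
    (hdeg : ∀ x, IsInteriorVertex D x → 6 ≤ ((skeleton D).neighborSet x).ncard)
    {x y z : W} (hxy : (skeleton D).Adj x y) (hyz : (skeleton D).Adj y z)
    (hzx : (skeleton D).Adj z x) : {x, y, z} ∈ triangleFinset D := by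
  let w : (skeleton D).Walk x x := .cons hxy (.cons hyz hzx.toWalk)
  have hpath : IsClosedPath D 3 w.getVert := isClosedPath_getVert w
  obtain ⟨C, hC, hbd⟩ := hpath.exists_triangleBoundary_eq hD
  have hinj : Set.InjOn w.getVert (Set.Iio 3) := by
    intro i hi k hk e
    have := hxy.1
    have := hyz.1
    have := hzx.1
    rw [Set.mem_Iio] at hi hk
    interval_cases i <;> interval_cases k <;> simp_all [w]
  have h : IsFilledPolygon D 3 w.getVert C := ⟨hpath, le_rfl, hinj, hC, hbd⟩
  have gb := h.gaussBonnet hD hdeg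
  have pos {i : ℕ} (hi : i < 3) := h.card_vertexStar_pos hD hi
  have h0 := pos (show 0 < 3 by simp)
  have h1 := pos (show 1 < 3 by simp)
  have h2 := pos (show 2 < 3 by simp)
  simp only [sum_range_succ, sum_range_zero] at gb
  exact hC <| h.triangle_mem_of_card_vertexStar_eq_one hD (i := 0)
    (by simp) (by simp only [zero_add]; omega)

end Geodesic

section Ball

variable {W : Type*} {D : AbstractSimplicialComplex W} {v : W} {n k : ℕ}

/-- The ball of radius `n` about `v` is not cut off by the boundary of the disc `D`, and `D` is
combinatorially nonpositively curved: all its interior vertices have degree at least `6`. -/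
structure IsInteriorBall (D : AbstractSimplicialComplex W) (v : W) (n : ℕ) : Prop where
  disc : IsDisc D
  six_le : ∀ x, IsInteriorVertex D x → 6 ≤ ((skeleton D).neighborSet x).ncard
  interior : ∀ x, (skeleton D).dist v x < n → IsInteriorVertex D x

namespace IsInteriorBall

lemma mono (h : IsInteriorBall D v n) (hk : k ≤ n) : IsInteriorBall D v k :=
  ⟨h.disc, h.six_le, fun x hx => h.interior x (hx.trans_le hk)⟩

lemma connected (h : IsInteriorBall D v n) : (skeleton D).Connected :=
  h.disc.simplyConnected.connected

lemma not_adj_of_dist_eq_zero (h : IsInteriorBall D v n) {x y : W}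
    (hx : (skeleton D).dist v x = 0) (hy : (skeleton D).dist v y = 0) : ¬ (skeleton D).Adj x y := by
  rw [h.connected.dist_eq_zero_iff] at hx hy
  exact fun hxy => hxy.ne (hx.symm.trans hy)

variable [Fintype W]

lemma dist_le_of_mem (h : IsInteriorBall D v n) {τ : Finset W}
    (hτ : τ ∈ triangleFinset D) {x y : W} (hx : x ∈ τ) (hy : y ∈ τ) :
    (skeleton D).dist v y ≤ (skeleton D).dist v x + 1 := by
  rcases eq_or_ne x y with rfl | hxy
  · exact Nat.le_succ _
  · exact dist_le_dist_add_one h.connected (adj_of_mem_triangleFinset hτ hx hy hxy)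

lemma not_link_triangle (h : IsInteriorBall D v n) {x a b c : W} (hx : (skeleton D).dist v x < n)
    (hab : {x, a, b} ∈ triangleFinset D) (hac : {x, a, c} ∈ triangleFinset D) :
    {x, b, c} ∉ triangleFinset D :=
  have hx' := h.interior x hx
  h.disc.not_link_triangle hx' ((by norm_num : 4 ≤ 6).trans (h.six_le x hx')) hab hac

lemma exists_lower_apex (h : IsInteriorBall D v n) {x y : W}
    (hx : (skeleton D).dist v x = k + 1) (hy : (skeleton D).dist v y = k + 1)
    (hxy : (skeleton D).Adj x y) :
    ∃ z, (skeleton D).dist v z = k ∧ {x, y, z} ∈ triangleFinset D := by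
  obtain ⟨z, hz, hzx, hzy⟩ := exists_common_lower h.disc h.six_le hx hy hxy
  exact ⟨z, hz, clique_triangle h.disc h.six_le hxy hzy.symm hzx⟩

lemma lower_apex_unique (h : IsInteriorBall D v n) (hk : k < n) {x y z z' : W}
    (hx : (skeleton D).dist v x = k + 1) (hy : (skeleton D).dist v y = k + 1)
    (hz : (skeleton D).dist v z = k) (hz' : (skeleton D).dist v z' = k)
    (hτ : {x, y, z} ∈ triangleFinset D) (hτ' : {x, y, z'} ∈ triangleFinset D) : z = z' := by
  by_contra hne
  obtain ⟨-, hxz, hyz⟩ := ne_of_triple_mem_triangleFinset hτ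
  obtain ⟨-, hxz', hyz'⟩ := ne_of_triple_mem_triangleFinset hτ'
  have lower {a : W} (ha : (skeleton D).dist v a = k + 1) (h1 : (skeleton D).Adj a z)
      (h2 : (skeleton D).Adj a z') : {z, a, z'} ∈ triangleFinset D := by
    rw [insert_comm]
    exact lower_triangle h.disc h.six_le ha hz hz' hne h1 h2
  refine h.not_link_triangle (hz.trans_lt hk) (a := x) (b := y) ?_
    (lower hx (adj_of_mem_triangleFinset hτ (by simp) (by simp) hxz)
      (adj_of_mem_triangleFinset hτ' (by simp) (by simp) hxz'))
    (lower hy (adj_of_mem_triangleFinset hτ (by simp) (by simp) hyz)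
      (adj_of_mem_triangleFinset hτ' (by simp) (by simp) hyz'))
  rwa [insert_comm, pair_comm z y]

/-- The lower apices of the three sides of such a triangle would span a triangle one level below. -/
lemma not_level_triangle (h : IsInteriorBall D v n) (hk : k ≤ n) {x y z : W}
    (hx : (skeleton D).dist v x = k) (hy : (skeleton D).dist v y = k)
    (hz : (skeleton D).dist v z = k) : {x, y, z} ∉ triangleFinset D := by
  intro hτ
  obtain ⟨hxy, hxz, hyz⟩ := ne_of_triple_mem_triangleFinset hτ
  have axy := adj_of_mem_triangleFinset hτ (by simp) (by simp) hxy
  have axz := adj_of_mem_triangleFinset hτ (by simp) (by simp) hxz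
  have ayz := adj_of_mem_triangleFinset hτ (by simp) (by simp) hyz
  induction k generalizing x y z with
  | zero => exact h.not_adj_of_dist_eq_zero hx hy axy
  | succ k ih =>
    obtain ⟨a, ha, xa, ya⟩ := exists_common_lower h.disc h.six_le hx hy axy
    obtain ⟨b, hb, xb, zb⟩ := exists_common_lower h.disc h.six_le hx hz axz
    obtain ⟨c, hc, yc, zc⟩ := exists_common_lower h.disc h.six_le hy hz ayz
    have not_common {w : W} (hw : (skeleton D).dist v w = k) (hwx : (skeleton D).Adj w x)
        (hwy : (skeleton D).Adj w y) : ¬ (skeleton D).Adj w z := fun hwz =>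
      h.not_link_triangle (hw.trans_lt hk) (clique_triangle h.disc h.six_le hwx axy hwy.symm)
        (clique_triangle h.disc h.six_le hwx axz hwz.symm)
        (clique_triangle h.disc h.six_le hwy ayz hwz.symm)
    have lower {p q r : W} (hp : (skeleton D).dist v p = k + 1) (hq : (skeleton D).dist v q = k)
        (hr : (skeleton D).dist v r = k) (hqp : (skeleton D).Adj q p) (hrp : (skeleton D).Adj r p)
        (hqr : q ≠ r) : (skeleton D).Adj q r :=
      adj_of_mem_triangleFinset (lower_triangle h.disc h.six_le hp hq hr hqr hqp.symm hrp.symm)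
        (by simp) (by simp) hqr
    have hab : a ≠ b := by rintro rfl; exact not_common ha xa ya zb
    have hac : a ≠ c := by rintro rfl; exact not_common ha xa ya zc
    have hbc : b ≠ c := by rintro rfl; exact not_common hb xb yc zb
    have aab := lower hx ha hb xa xb hab
    have aac := lower hy ha hc ya yc hac
    have abc := lower hz hb hc zb zc hbc
    exact ih (Nat.le_of_lt hk) ha hb hc (clique_triangle h.disc h.six_le aab abc aac.symm)
      hab hac hbc aab aac abc

lemma existsUnique_upper_apex (h : IsInteriorBall D v n) (hk : k + 1 < n) {x y : W}
    (hx : (skeleton D).dist v x = k + 1) (hy : (skeleton D).dist v y = k + 1)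
    (hxy : (skeleton D).Adj x y) :
    ∃! z, (skeleton D).dist v z = k + 2 ∧ {x, y, z} ∈ triangleFinset D := by
  obtain ⟨z₀, hz₀, hτ₀⟩ := h.exists_lower_apex hx hy hxy
  have hcard := h.disc.card_edgeStar_of_interior hxy (h.interior x (by omega))
  obtain ⟨τ, hτ, hne⟩ := exists_mem_ne (hcard.symm ▸ one_lt_two) ({x, y, z₀} : Finset W)
  obtain ⟨hτT, hxτ, hyτ⟩ := mem_edgeStar.1 hτ
  obtain ⟨z, hxz, hyz, rfl⟩ := exists_eq_triple (mem_triangleFinset.1 hτT).2 hxτ hyτ hxy.ne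
  have hzz₀ : z₀ ≠ z := by rintro rfl; exact hne rfl
  have hz : (skeleton D).dist v z = k + 2 := by
    have h1 := h.dist_le_of_mem hτT hxτ (y := z) (by simp)
    have h2 := h.dist_le_of_mem hτT (x := z) (by simp) hxτ
    have h3 : (skeleton D).dist v z ≠ k := fun e =>
      hzz₀ (h.lower_apex_unique (by omega) hx hy hz₀ e hτ₀ hτT)
    have h4 : (skeleton D).dist v z ≠ k + 1 := fun e => h.not_level_triangle hk.le hx hy e hτT
    omega
  refine ⟨z, ⟨hz, hτT⟩, fun r ⟨hr, hrT⟩ => ?_⟩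
  have hrz₀ : r ≠ z₀ := fun e => by rw [e, hz₀] at hr; omega
  obtain ⟨-, hxr, hyr⟩ := ne_of_triple_mem_triangleFinset hrT
  rcases h.disc.eq_or_eq_of_mem_edgeStar hzz₀ hτ₀ hτT
    (mem_edgeStar.2 ⟨hrT, by simp, by simp⟩) with e | e
  · have hmem := e.subset (show r ∈ {x, y, r} by simp)
    simp [hxr.symm, hyr.symm, hrz₀] at hmem
  · have hmem := e.subset (show r ∈ {x, y, r} by simp)
    simpa [hxr.symm, hyr.symm] using hmem

lemma existsUnique_apex (h : IsInteriorBall D v n) {p q : ℕ} (hpq : p + 1 = q ∨ q + 1 = p)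
    (hn : min p q < n) {x y : W} (hx : (skeleton D).dist v x = p) (hy : (skeleton D).dist v y = p)
    (hxy : (skeleton D).Adj x y) :
    ∃! z, (skeleton D).dist v z = q ∧ {x, y, z} ∈ triangleFinset D := by
  rcases hpq with rfl | rfl
  · cases p with
    | zero => exact (h.not_adj_of_dist_eq_zero hx hy hxy).elim
    | succ k => exact h.existsUnique_upper_apex (by omega) hx hy hxy
  · obtain ⟨z, hz, hτ⟩ := h.exists_lower_apex hx hy hxy
    exact ⟨z, ⟨hz, hτ⟩, fun r ⟨hr, hrT⟩ => h.lower_apex_unique (by omega) hx hy hr hz hrT hτ⟩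

end IsInteriorBall

end Ball

section Layers

variable {W : Type*} {D : AbstractSimplicialComplex W} {v : W} {n k p q : ℕ}

variable (D v k) in
/-- The vertices of `σ` at distance `k` from `v`. -/
def atLevel (σ : Finset W) : Finset W := σ.filter fun x => (skeleton D).dist v x = k

lemma mem_atLevel {σ : Finset W} {x : W} :
    x ∈ atLevel D v k σ ↔ x ∈ σ ∧ (skeleton D).dist v x = k := mem_filter

lemma card_atLevel_triple {x y z : W} (hxy : x ≠ y) (hxz : x ≠ z) (hyz : y ≠ z) :
    #(atLevel D v k {x, y, z}) = (if (skeleton D).dist v x = k then 1 else 0) +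
      ((if (skeleton D).dist v y = k then 1 else 0) +
        if (skeleton D).dist v z = k then 1 else 0) := by
  rw [atLevel, card_filter, sum_insert (by simp [hxy, hxz]), sum_pair hyz]

lemma atLevel_triple {x y z : W} (hpq : p ≠ q) (hx : (skeleton D).dist v x = p)
    (hy : (skeleton D).dist v y = p) (hz : (skeleton D).dist v z = q) :
    atLevel D v p {x, y, z} = {x, y} := by
  simp [atLevel, filter_insert, filter_singleton, hx, hy, hz, hpq.symm]

variable [Fintype W]

variable (D v k) in
/-- The edges of the sphere of radius `k` about `v`, as a `Finset`. -/
def sphereFinset : Finset (Finset W) := univ.filter (· ∈ sphere D v k)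

lemma mem_sphereFinset {e : Finset W} : e ∈ sphereFinset D v k ↔
    e ∈ D.faces ∧ #e = 2 ∧ ∀ x ∈ e, (skeleton D).dist v x = k :=
  mem_filter.trans (and_iff_right (mem_univ e))

lemma card_sphereFinset : #(sphereFinset D v k) = sphereLength D v k := by
  rw [sphereLength, ← Set.ncard_coe_finset]
  simp [sphereFinset]

lemma exists_eq_pair_of_mem_sphereFinset {e : Finset W} (he : e ∈ sphereFinset D v k) :
    ∃ x y, (skeleton D).Adj x y ∧ (skeleton D).dist v x = k ∧ (skeleton D).dist v y = k ∧
      e = {x, y} := by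
  obtain ⟨hf, h2, hlev⟩ := mem_sphereFinset.1 he
  obtain ⟨x, y, hxy, rfl⟩ := card_eq_two.1 h2
  exact ⟨x, y, ⟨hxy, hf⟩, hlev x (by simp), hlev y (by simp), rfl⟩

variable (D v p q) in
/-- The triangles with two vertices at distance `p` and one vertex, the apex, at distance `q`
from `v`. -/
def layer : Finset (Finset W) :=
  (triangleFinset D).filter fun τ => #(atLevel D v p τ) = 2 ∧ #(atLevel D v q τ) = 1

lemma mem_layer {τ : Finset W} : τ ∈ layer D v p q ↔
    τ ∈ triangleFinset D ∧ #(atLevel D v p τ) = 2 ∧ #(atLevel D v q τ) = 1 := mem_filter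

lemma triple_mem_layer {x y z : W} (hpq : p ≠ q) (h : {x, y, z} ∈ triangleFinset D)
    (hx : (skeleton D).dist v x = p) (hy : (skeleton D).dist v y = p)
    (hz : (skeleton D).dist v z = q) : {x, y, z} ∈ layer D v p q := by
  obtain ⟨hxy, hxz, hyz⟩ := ne_of_triple_mem_triangleFinset h
  simp [mem_layer, h, card_atLevel_triple hxy hxz hyz, hx, hy, hz, hpq, hpq.symm]

lemma exists_eq_triple_of_mem_layer (hpq : p ≠ q) {τ : Finset W} (hτ : τ ∈ layer D v p q) :
    ∃ x y z, (skeleton D).dist v x = p ∧ (skeleton D).dist v y = p ∧ (skeleton D).dist v z = q ∧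
      τ = {x, y, z} := by
  obtain ⟨hτT, hp, hq⟩ := mem_layer.1 hτ
  obtain ⟨x, y, hxy, hxye⟩ := card_eq_two.1 hp
  obtain ⟨hx, hxp⟩ := mem_atLevel.1 (hxye.symm.subset (show x ∈ {x, y} by simp))
  obtain ⟨hy, hyp⟩ := mem_atLevel.1 (hxye.symm.subset (show y ∈ {x, y} by simp))
  obtain ⟨z, -, -, rfl⟩ := exists_eq_triple (mem_triangleFinset.1 hτT).2 hx hy hxy
  obtain ⟨w, hw⟩ := card_pos.1 (hq.symm ▸ one_pos)
  obtain ⟨hw, hwq⟩ := mem_atLevel.1 hw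
  simp only [mem_insert, mem_singleton] at hw
  rcases hw with rfl | rfl | rfl
  · exact (hpq (hxp.symm.trans hwq)).elim
  · exact (hpq (hyp.symm.trans hwq)).elim
  · exact ⟨x, y, w, hxp, hyp, hwq, rfl⟩

lemma atLevel_mem_sphereFinset {τ : Finset W} (h : τ ∈ layer D v p q) :
    atLevel D v p τ ∈ sphereFinset D v p := by
  obtain ⟨hτ, hp, -⟩ := mem_layer.1 h
  exact mem_sphereFinset.2 ⟨mem_faces_of_subset (mem_triangleFinset.1 hτ).1 (filter_subset _ _)
    (card_pos.1 (by omega)), hp, fun x hx => (mem_atLevel.1 hx).2⟩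

lemma dist_eq_or_eq_of_mem_layer (hpq : p ≠ q) {τ : Finset W} (hτ : τ ∈ layer D v p q) {x : W}
    (hx : x ∈ τ) : (skeleton D).dist v x = p ∨ (skeleton D).dist v x = q := by
  obtain ⟨a, b, c, ha, hb, hc, rfl⟩ := exists_eq_triple_of_mem_layer hpq hτ
  simp only [mem_insert, mem_singleton] at hx
  rcases hx with rfl | rfl | rfl <;> simp [*]

lemma sum_atLevel_add_sum_atLevel {M : Type*} [AddCommMonoid M] (hpq : p ≠ q) {τ : Finset W}
    (hτ : τ ∈ layer D v p q) (w : W → M) :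
    ∑ x ∈ atLevel D v p τ, w x + ∑ x ∈ atLevel D v q τ, w x = ∑ x ∈ τ, w x := by
  have hq : atLevel D v q τ = τ.filter fun x => ¬ (skeleton D).dist v x = p :=
    filter_congr fun x hx => by rcases dist_eq_or_eq_of_mem_layer hpq hτ hx <;> omega
  rw [hq]
  exact sum_filter_add_sum_filter_not τ _ w

namespace IsInteriorBall

theorem bijOn_layer (h : IsInteriorBall D v n) (hpq : p + 1 = q ∨ q + 1 = p) (hn : min p q < n) :
    Set.BijOn (atLevel D v p) (layer D v p q) (sphereFinset D v p) := by
  have hne : p ≠ q := by omega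
  refine ⟨fun τ hτ => atLevel_mem_sphereFinset hτ, fun τ hτ τ' hτ' he => ?_, fun e he => ?_⟩
  · obtain ⟨x, y, z, hx, hy, hz, rfl⟩ := exists_eq_triple_of_mem_layer hne hτ
    obtain ⟨x', y', z', hx', hy', hz', rfl⟩ := exists_eq_triple_of_mem_layer hne hτ'
    rw [atLevel_triple hne hx hy hz, atLevel_triple hne hx' hy' hz'] at he
    have triple_eq : ({x', y', z'} : Finset W) = {x, y, z'} := by
      simpa only [insert_union, singleton_union] using congrArg (· ∪ {z'}) he.symm
    have hτT := (mem_layer.1 hτ).1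
    have hτT' := triple_eq ▸ (mem_layer.1 hτ').1
    have hxy := adj_of_mem_triangleFinset hτT (by simp) (by simp)
      (ne_of_triple_mem_triangleFinset hτT).1
    rw [triple_eq, (h.existsUnique_apex hpq hn hx hy hxy).unique ⟨hz, hτT⟩ ⟨hz', hτT'⟩]
  · obtain ⟨x, y, hxy, hx, hy, rfl⟩ := exists_eq_pair_of_mem_sphereFinset he
    obtain ⟨z, hz, hτ⟩ := (h.existsUnique_apex hpq hn hx hy hxy).exists
    exact ⟨_, triple_mem_layer hne hτ hx hy hz, atLevel_triple hne hx hy hz⟩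

lemma sum_layer {M : Type*} [AddCommMonoid M] (h : IsInteriorBall D v n)
    (hpq : p + 1 = q ∨ q + 1 = p) (hn : min p q < n) (g : Finset W → M) :
    ∑ τ ∈ layer D v p q, g (atLevel D v p τ) = ∑ e ∈ sphereFinset D v p, g e :=
  have hbij := h.bijOn_layer hpq hn
  sum_nbij _ hbij.mapsTo hbij.injOn hbij.surjOn fun _ _ => rfl

lemma card_layer (h : IsInteriorBall D v n) (hpq : p + 1 = q ∨ q + 1 = p) (hn : min p q < n) :
    #(layer D v p q) = sphereLength D v p := by
  rw [← card_sphereFinset, card_eq_sum_ones, card_eq_sum_ones]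
  exact h.sum_layer hpq hn fun _ => 1

lemma card_atLevel (h : IsInteriorBall D v n) (hk : k + 1 ≤ n) {τ : Finset W}
    (hτ : τ ∈ triangleFinset D) {x : W} (hx : x ∈ atLevel D v (k + 1) τ) :
    #(atLevel D v (k + 1) τ) = 2 ∧ #(atLevel D v k τ) = 1 ∧ #(atLevel D v (k + 2) τ) = 0 ∨
    #(atLevel D v (k + 1) τ) = 2 ∧ #(atLevel D v k τ) = 0 ∧ #(atLevel D v (k + 2) τ) = 1 ∨
    #(atLevel D v (k + 1) τ) = 1 ∧ #(atLevel D v k τ) = 2 ∧ #(atLevel D v (k + 2) τ) = 0 ∨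
    #(atLevel D v (k + 1) τ) = 1 ∧ #(atLevel D v k τ) = 0 ∧ #(atLevel D v (k + 2) τ) = 2 := by
  obtain ⟨hxτ, hxk⟩ := mem_atLevel.1 hx
  obtain ⟨y, hyτ, hyx⟩ := exists_mem_ne (show 1 < #τ by rw [(mem_triangleFinset.1 hτ).2]; simp) x
  obtain ⟨z, hxz, hyz, rfl⟩ := exists_eq_triple (mem_triangleFinset.1 hτ).2 hxτ hyτ hyx.symm
  have hflat : ¬ ((skeleton D).dist v y = k + 1 ∧ (skeleton D).dist v z = k + 1) :=
    fun ⟨hy, hz⟩ => h.not_level_triangle hk hxk hy hz hτ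
  have hz : z ∈ ({x, y, z} : Finset W) := by simp
  have xy := h.dist_le_of_mem hτ hxτ hyτ
  have yx := h.dist_le_of_mem hτ hyτ hxτ
  have xz := h.dist_le_of_mem hτ hxτ hz
  have zx := h.dist_le_of_mem hτ hz hxτ
  have yz := h.dist_le_of_mem hτ hyτ hz
  have zy := h.dist_le_of_mem hτ hz hyτ
  simp only [card_atLevel_triple hyx.symm hxz hyz]
  split_ifs <;> omega

lemma vertexStar_center (h : IsInteriorBall D v n) :
    vertexStar (triangleFinset D) v = layer D v 1 0 := by
  have hconn := h.connected
  ext τ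
  rw [mem_vertexStar]
  constructor
  · rintro ⟨hτ, hv⟩
    obtain ⟨x, hx, hxv⟩ := exists_mem_ne (show 1 < #τ by rw [(mem_triangleFinset.1 hτ).2]; simp) v
    obtain ⟨y, hvy, -, rfl⟩ := exists_eq_triple (mem_triangleFinset.1 hτ).2 hv hx hxv.symm
    have dist_eq_one {z : W} (hz : z ∈ ({v, x, y} : Finset W)) (hvz : v ≠ z) :
        (skeleton D).dist v z = 1 :=
      SimpleGraph.dist_eq_one_iff_adj.2 (adj_of_mem_triangleFinset hτ hv hz hvz)
    have perm : ({v, x, y} : Finset W) = {x, y, v} := by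
      rw [insert_comm, pair_comm]
    rw [perm]
    exact triple_mem_layer one_ne_zero (perm ▸ hτ) (dist_eq_one hx hxv.symm)
      (dist_eq_one (by simp) hvy) SimpleGraph.dist_self
  · intro hτ
    refine ⟨(mem_layer.1 hτ).1, ?_⟩
    obtain ⟨x, y, z, -, -, hz, rfl⟩ := exists_eq_triple_of_mem_layer one_ne_zero hτ
    simp [hconn.dist_eq_zero_iff.1 hz]

end IsInteriorBall

end Layers

section Degree

variable {W : Type*} [Fintype W] {D : AbstractSimplicialComplex W} {v x : W} {n k : ℕ}

variable (D v x) in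
/-- The neighbours of `x` that are closer to `v` than `x`. -/
def lowerNeighborFinset : Finset W :=
  univ.filter fun a => (skeleton D).Adj x a ∧ (skeleton D).dist v a + 1 = (skeleton D).dist v x

lemma mem_lowerNeighborFinset {a : W} : a ∈ lowerNeighborFinset D v x ↔
    (skeleton D).Adj x a ∧ (skeleton D).dist v a + 1 = (skeleton D).dist v x :=
  mem_filter.trans (and_iff_right (mem_univ a))

lemma atLevel_eq_filter_lowerNeighborFinset (hx : (skeleton D).dist v x = k + 1) {τ : Finset W}
    (hτ : τ ∈ vertexStar (triangleFinset D) x) :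
    atLevel D v k τ = (lowerNeighborFinset D v x).filter (· ∈ τ) := by
  obtain ⟨hτT, hxτ⟩ := mem_vertexStar.1 hτ
  ext a
  rw [mem_atLevel, mem_filter, mem_lowerNeighborFinset, hx, add_left_inj]
  refine ⟨fun ⟨ha, hak⟩ => ⟨⟨adj_of_mem_triangleFinset hτT hxτ ha ?_, hak⟩, ha⟩,
    fun ⟨⟨_, hak⟩, ha⟩ => ⟨ha, hak⟩⟩
  rintro rfl
  omega

namespace IsInteriorBall

lemma lower_triangle_mem (h : IsInteriorBall D v n) (hx : (skeleton D).dist v x = k + 1) {a b : W}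
    (ha : a ∈ lowerNeighborFinset D v x) (hb : b ∈ lowerNeighborFinset D v x) (hab : a ≠ b) :
    {x, a, b} ∈ triangleFinset D := by
  rw [mem_lowerNeighborFinset, hx, add_left_inj] at ha hb
  exact lower_triangle h.disc h.six_le hx ha.2 hb.2 hab ha.1 hb.1

lemma card_lowerNeighborFinset (h : IsInteriorBall D v n) (hk : k + 1 < n)
    (hx : (skeleton D).dist v x = k + 1) :
    #(lowerNeighborFinset D v x) = 1 ∨ #(lowerNeighborFinset D v x) = 2 := by
  have pos : 0 < #(lowerNeighborFinset D v x) := by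
    obtain ⟨a, hxa, ha⟩ := exists_lower h.connected hx
    exact card_pos.2 ⟨a, mem_lowerNeighborFinset.2 ⟨hxa, by rw [ha, hx]⟩⟩
  have lt_three : #(lowerNeighborFinset D v x) < 3 := by
    by_contra! h3
    obtain ⟨a, b, c, ha, hb, hc, hab, hac, hbc⟩ := two_lt_card_iff.1 h3
    exact h.not_link_triangle (by omega) (h.lower_triangle_mem hx ha hb hab)
      (h.lower_triangle_mem hx ha hc hac) (h.lower_triangle_mem hx hb hc hbc)
  omega

lemma card_filter_layer_lower (h : IsInteriorBall D v n) (hk : k < n)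
    (hx : (skeleton D).dist v x = k + 1) :
    #((layer D v (k + 1) k).filter (x ∈ ·)) = #((sphereFinset D v (k + 1)).filter (x ∈ ·)) := by
  rw [card_filter, card_filter, ← h.sum_layer (.inr rfl) (by omega)]
  simp only [mem_atLevel, hx, and_true]

lemma card_filter_layer_upper (h : IsInteriorBall D v n) (hx : (skeleton D).dist v x = k + 1) :
    #((layer D v k (k + 1)).filter (x ∈ ·)) = (#(lowerNeighborFinset D v x)).choose 2 := by
  have hne : k ≠ k + 1 := k.lt_succ_self.ne
  have exists_triple {τ : Finset W} (hτ : τ ∈ (layer D v k (k + 1)).filter (x ∈ ·)) :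
      ∃ a b, atLevel D v k τ = {a, b} ∧ τ = {a, b, x} := by
    obtain ⟨hτ, hxτ⟩ := mem_filter.1 hτ
    obtain ⟨a, b, c, ha, hb, hc, rfl⟩ := exists_eq_triple_of_mem_layer hne hτ
    obtain rfl : x = c := by
      simp only [mem_insert, mem_singleton] at hxτ
      rcases hxτ with rfl | rfl | hxc
      · omega
      · omega
      · exact hxc
    exact ⟨a, b, atLevel_triple hne ha hb hc, rfl⟩
  rw [← card_powersetCard]
  refine card_nbij (atLevel D v k) (fun τ hτ => ?_) (fun τ hτ τ' hτ' he => ?_) fun e he => ?_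
  · obtain ⟨hτ, hxτ⟩ := mem_filter.1 hτ
    obtain ⟨hτT, h2, -⟩ := mem_layer.1 hτ
    refine mem_powersetCard.2 ⟨?_, h2⟩
    rw [atLevel_eq_filter_lowerNeighborFinset hx (mem_vertexStar.2 ⟨hτT, hxτ⟩)]
    exact filter_subset _ _
  · obtain ⟨a, b, hab, rfl⟩ := exists_triple hτ
    obtain ⟨a', b', hab', rfl⟩ := exists_triple hτ'
    simpa only [insert_union, singleton_union] using
      congrArg (· ∪ {x}) (hab.symm.trans (he.trans hab'))
  · obtain ⟨hsub, h2⟩ := mem_powersetCard.1 he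
    obtain ⟨a, b, hab, rfl⟩ := card_eq_two.1 h2
    have ha := hsub (show a ∈ _ by simp)
    have hb := hsub (show b ∈ _ by simp)
    have hτ : {a, b, x} ∈ triangleFinset D := by
      rw [pair_comm, insert_comm]
      exact h.lower_triangle_mem hx ha hb hab
    rw [mem_lowerNeighborFinset, hx, add_left_inj] at ha hb
    exact ⟨{a, b, x}, mem_filter.2 ⟨triple_mem_layer hne hτ ha.2 hb.2 hx, by simp⟩,
      atLevel_triple hne ha.2 hb.2 hx⟩

/-- Double counting of the triangles on the `d ≤ 2` edges from `x` to the previous sphere: each edge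
lies on two of them, and each lies on one edge, except for the `d.choose 2` triangles that join `x`
to an edge of the previous sphere. -/
lemma card_filter_sphereFinset (h : IsInteriorBall D v n) (hk : k + 1 < n)
    (hx : (skeleton D).dist v x = k + 1) : #((sphereFinset D v (k + 1)).filter (x ∈ ·)) = 2 := by
  have two_mul_card : 2 * #(lowerNeighborFinset D v x) =
      ∑ τ ∈ vertexStar (triangleFinset D) x, #(atLevel D v k τ) := by
    rw [sum_congr rfl fun τ hτ => by rw [atLevel_eq_filter_lowerNeighborFinset hx hτ], mul_comm]
    refine (sum_const_nat fun a ha => ?_).symm.trans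
      (sum_card_bipartiteAbove_eq_sum_card_bipartiteBelow fun a τ => a ∈ τ)
    rw [bipartiteAbove, ← edgeStar_eq_filter_vertexStar]
    exact h.disc.card_edgeStar_of_interior (mem_lowerNeighborFinset.1 ha).1
      (h.interior x (by omega))
  have sum_eq : ∑ τ ∈ vertexStar (triangleFinset D) x, #(atLevel D v k τ) =
      #((layer D v (k + 1) k).filter (x ∈ ·)) + 2 * #((layer D v k (k + 1)).filter (x ∈ ·)) := by
    simp only [layer, card_filter, vertexStar, sum_filter, mul_sum, ← sum_add_distrib]
    refine sum_congr rfl fun τ hτ => ?_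
    by_cases hxτ : x ∈ τ
    · rcases h.card_atLevel hk.le hτ (mem_atLevel.2 ⟨hxτ, hx⟩) with h | h | h | h <;> simp [h, hxτ]
    · simp [hxτ]
  rw [h.card_filter_layer_lower (by omega) hx, h.card_filter_layer_upper hx] at sum_eq
  rcases h.card_lowerNeighborFinset hk hx with hd | hd <;> rw [hd] at two_mul_card sum_eq
  · rw [Nat.choose_succ_self] at sum_eq
    omega
  · rw [Nat.choose_self] at sum_eq
    omega

end IsInteriorBall

end Degree

section Weights

variable {W : Type*} [Fintype W] {D : AbstractSimplicialComplex W} {v : W} {n k p q : ℕ}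
  {w : W → ℝ} {c : ℝ}

variable (D v) in
/-- The total weight of the edges of the sphere of radius `k`, where the weight of an edge is the
sum of the weights of its endpoints. -/
def edgeWeight (w : W → ℝ) (k : ℕ) : ℝ := ∑ e ∈ sphereFinset D v k, ∑ x ∈ e, w x

lemma sum_atLevel_mul_card_vertexStar (T : Finset (Finset W)) :
    ∑ x ∈ atLevel D v k univ, w x * #(vertexStar T x) = ∑ τ ∈ T, ∑ x ∈ atLevel D v k τ, w x := by
  simp only [vertexStar, card_filter, Nat.cast_sum, Nat.cast_ite, Nat.cast_one, Nat.cast_zero,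
    mul_sum, mul_ite, mul_one, mul_zero]
  rw [sum_comm]
  refine sum_congr rfl fun τ _ => ?_
  rw [← sum_filter, atLevel, atLevel, filter_comm, filter_univ_mem]

namespace IsInteriorBall

omit [Fintype W] in
lemma atLevel_zero (h : IsInteriorBall D v n) {σ : Finset W} (hv : v ∈ σ) :
    atLevel D v 0 σ = {v} := by
  ext x
  rw [mem_atLevel, mem_singleton, h.connected.dist_eq_zero_iff]
  exact ⟨fun ⟨_, hx⟩ => hx.symm, by rintro rfl; exact ⟨hv, rfl⟩⟩

lemma edgeWeight_eq (h : IsInteriorBall D v n) (hk : k + 1 < n) (w : W → ℝ) :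
    edgeWeight D v w (k + 1) = 2 * ∑ x ∈ atLevel D v (k + 1) univ, w x := by
  have swap : ∑ x ∈ atLevel D v (k + 1) univ, w x * #(vertexStar (sphereFinset D v (k + 1)) x) =
      edgeWeight D v w (k + 1) := by
    rw [sum_atLevel_mul_card_vertexStar]
    refine sum_congr rfl fun e he => ?_
    rw [atLevel, filter_true_of_mem (mem_sphereFinset.1 he).2.2]
  rw [← swap, mul_sum]
  refine sum_congr rfl fun x hx => ?_
  rw [vertexStar, h.card_filter_sphereFinset hk (mem_atLevel.1 hx).2, mul_comm, Nat.cast_two]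

lemma sum_base (h : IsInteriorBall D v n) (hpq : p + 1 = q ∨ q + 1 = p) (hn : min p q < n)
    (w : W → ℝ) :
    ∑ τ ∈ layer D v p q, ∑ x ∈ atLevel D v p τ, w x = edgeWeight D v w p :=
  h.sum_layer hpq hn fun e => ∑ x ∈ e, w x

lemma sum_apex (h : IsInteriorBall D v n) (hpq : p + 1 = q ∨ q + 1 = p) (hn : min p q < n)
    (hw : ∀ τ ∈ layer D v p q, ∑ x ∈ τ, w x = c) :
    ∑ τ ∈ layer D v p q, ∑ x ∈ atLevel D v q τ, w x =
      c * sphereLength D v p - edgeWeight D v w p := by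
  have hne : p ≠ q := by omega
  rw [← h.sum_base hpq hn, ← h.card_layer hpq hn, eq_sub_iff_add_eq', ← sum_add_distrib, mul_comm,
    ← nsmul_eq_mul, ← sum_const]
  exact sum_congr rfl fun τ hτ => (sum_atLevel_add_sum_atLevel hne hτ w).trans (hw τ hτ)

lemma sum_atLevel_triangleFinset (h : IsInteriorBall D v n) (hk : k + 1 ≤ n) (w : W → ℝ) :
    ∑ τ ∈ triangleFinset D, ∑ x ∈ atLevel D v (k + 1) τ, w x =
      ∑ τ ∈ layer D v (k + 2) (k + 1), ∑ x ∈ atLevel D v (k + 1) τ, w x +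
      ∑ τ ∈ layer D v (k + 1) (k + 2), ∑ x ∈ atLevel D v (k + 1) τ, w x +
      ∑ τ ∈ layer D v (k + 1) k, ∑ x ∈ atLevel D v (k + 1) τ, w x +
      ∑ τ ∈ layer D v k (k + 1), ∑ x ∈ atLevel D v (k + 1) τ, w x := by
  simp only [layer, sum_filter, ← sum_add_distrib]
  refine sum_congr rfl fun τ hτ => ?_
  rcases (atLevel D v (k + 1) τ).eq_empty_or_nonempty with hempty | ⟨x, hx⟩
  · simp [hempty]
  · rcases h.card_atLevel hk hτ hx with h | h | h | h <;> simp [h]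

/-- A triangle meeting level `k + 1` lies in one of the four layers next to that level. -/
theorem sum_mul_degree (h : IsInteriorBall D v n) (hk : k + 1 < n)
    (hw : ∀ τ ∈ triangleFinset D, (∀ x ∈ τ, (skeleton D).dist v x ≤ k + 2) → ∑ x ∈ τ, w x = c) :
    ∑ x ∈ atLevel D v (k + 1) univ, w x * ((skeleton D).neighborSet x).ncard =
      c * (sphereLength D v (k + 2) + sphereLength D v k) - edgeWeight D v w (k + 2) -
        edgeWeight D v w k + 2 * edgeWeight D v w (k + 1) := by
  have degree_eq : ∀ x ∈ atLevel D v (k + 1) univ, w x * ((skeleton D).neighborSet x).ncard =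
      w x * #(vertexStar (triangleFinset D) x) := fun x hx => by
    rw [h.disc.card_vertexStar_of_interior (h.interior x ((mem_atLevel.1 hx).2.trans_lt hk))]
  have sum_eq {p q : ℕ} (hpq : p ≠ q) (hp : p ≤ k + 2) (hq : q ≤ k + 2) :
      ∀ τ ∈ layer D v p q, ∑ x ∈ τ, w x = c := fun τ hτ =>
    hw τ (mem_layer.1 hτ).1 fun x hx => by
      rcases dist_eq_or_eq_of_mem_layer hpq hτ hx with e | e <;> omega
  rw [sum_congr rfl degree_eq, sum_atLevel_mul_card_vertexStar,
    h.sum_atLevel_triangleFinset hk.le,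
    h.sum_apex (.inr rfl) (by omega) (sum_eq (by omega) (by omega) (by omega)),
    h.sum_apex (.inl rfl) (by omega) (sum_eq (by omega) (by omega) (by omega)),
    h.sum_base (.inl rfl) (by omega), h.sum_base (.inr rfl) (by omega)]
  ring

theorem center_mul_degree (h : IsInteriorBall D v n) (hn : 0 < n)
    (hw : ∀ τ ∈ triangleFinset D, (∀ x ∈ τ, (skeleton D).dist v x ≤ 1) → ∑ x ∈ τ, w x = c) :
    w v * ((skeleton D).neighborSet v).ncard = c * sphereLength D v 1 - edgeWeight D v w 1 := by
  rw [← h.sum_apex (q := 0) (.inr rfl) (by omega) fun τ hτ => hw τ (mem_layer.1 hτ).1 fun x hx => by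
      rcases dist_eq_or_eq_of_mem_layer one_ne_zero hτ hx with e | e <;> omega,
    ← h.disc.card_vertexStar_of_interior (h.interior v (by simpa using hn)), mul_comm,
    ← nsmul_eq_mul, h.vertexStar_center, ← sum_const]
  refine sum_congr rfl fun τ hτ => ?_
  rw [← h.vertexStar_center] at hτ
  rw [h.atLevel_zero (mem_vertexStar.1 hτ).2, sum_singleton]

end IsInteriorBall

lemma sphereArea_eq_card : sphereArea D v n =
    #((triangleFinset D).filter fun τ => ∀ x ∈ τ, (skeleton D).dist v x ≤ n) := by
  rw [sphereArea, ← Set.ncard_coe_finset]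
  congr 1
  ext τ
  simp [triangleFinset]

namespace IsInteriorBall

omit [Fintype W]

lemma sphereArea_zero (h : IsInteriorBall D v 0) : sphereArea D v 0 = 0 := by
  have := h.disc.finite
  cases nonempty_fintype W
  rw [sphereArea_eq_card, card_eq_zero, filter_eq_empty_iff]
  intro τ hτ hle
  obtain ⟨x, y, z, -, -, -, rfl⟩ := card_eq_three.1 (mem_triangleFinset.1 hτ).2
  have dist_eq_zero {a : W} (ha : a ∈ ({x, y, z} : Finset W)) : (skeleton D).dist v a = 0 :=
    Nat.le_zero.1 (hle a ha)
  exact h.not_level_triangle le_rfl (dist_eq_zero (by simp)) (dist_eq_zero (by simp))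
    (dist_eq_zero (by simp)) hτ

lemma sphereArea_succ (h : IsInteriorBall D v (n + 1)) :
    sphereArea D v (n + 1) =
      sphereArea D v n + (sphereLength D v n + sphereLength D v (n + 1)) := by
  have := h.disc.finite
  cases nonempty_fintype W
  rw [← h.card_layer (.inl rfl) (by omega), ← h.card_layer (.inr rfl) (by omega),
    sphereArea_eq_card, sphereArea_eq_card]
  simp only [layer, card_filter, ← sum_add_distrib]
  refine sum_congr rfl fun τ hτ => ?_
  rcases (atLevel D v (n + 1) τ).eq_empty_or_nonempty with hempty | ⟨x, hx⟩
  · have dist_ne {y : W} (hy : y ∈ τ) : (skeleton D).dist v y ≠ n + 1 :=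
      filter_eq_empty_iff.1 hempty hy
    have le_iff : (∀ y ∈ τ, (skeleton D).dist v y ≤ n + 1) ↔ ∀ y ∈ τ, (skeleton D).dist v y ≤ n :=
      forall₂_congr fun y hy => by have := dist_ne hy; omega
    simp [hempty, le_iff]
  · obtain ⟨hxτ, hxn⟩ := mem_atLevel.1 hx
    have not_le : ¬ ∀ y ∈ τ, (skeleton D).dist v y ≤ n := fun hle => by
      have := hle x hxτ
      omega
    have le_iff : (∀ y ∈ τ, (skeleton D).dist v y ≤ n + 1) ↔ #(atLevel D v (n + 2) τ) = 0 := by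
      rw [card_eq_zero, atLevel, filter_eq_empty_iff]
      refine forall₂_congr fun y hy => ?_
      have := h.dist_le_of_mem hτ hxτ hy
      omega
    rcases h.card_atLevel le_rfl hτ hx with h | h | h | h <;> simp [h, not_le, le_iff]

theorem sphereArea_eq (h : IsInteriorBall D v n) :
    sphereArea D v n = ∑ k ∈ range n, (sphereLength D v k + sphereLength D v (k + 1)) := by
  induction n with
  | zero => rw [h.sphereArea_zero, range_zero, sum_empty]
  | succ n ih => rw [h.sphereArea_succ, ih (h.mono n.le_succ), sum_range_succ]

end IsInteriorBall

end Weights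

section Uniform

variable {W : Type*} {D : AbstractSimplicialComplex W} {v : W} {n k s t : ℕ} {w : W → ℝ}

/-- A fractional version of the indicator function of the `s`-vertices of an `(s,t)`-uniform disc,
which treats the cases `s = t` (with the constant weight `1 / 3`) and `s ≠ t` (with the indicator
function itself) simultaneously. -/
structure IsVertexWeight (D : AbstractSimplicialComplex W) (s t : ℕ) (w : W → ℝ) : Prop where
  mem : ∀ x, w x ∈ ({0, 1 / 3, 1} : Finset ℝ)
  degree : ∀ x, IsInteriorVertex D x → ((skeleton D).neighborSet x).ncard = t + (s - t) * w x
  mul_degree : ∀ x, IsInteriorVertex D x → w x * ((skeleton D).neighborSet x).ncard = s * w x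
  sum_eq_one : ∀ τ ∈ triangles D, (∀ x ∈ τ, IsInteriorVertex D x) → ∑ x ∈ τ, w x = 1

lemma IsKVertex.eq {x : W} (hs : IsKVertex D s x) (ht : IsKVertex D t x) : s = t :=
  hs.2.symm.trans ht.2

lemma odd_add_of_cycleGraph_adj (ht : Even t) {i j : Fin t}
    (h : (SimpleGraph.cycleGraph t).Adj i j) : Odd (i.val + j.val) := by
  have odd_add {a b : Fin t} (hab : (a - b).val = 1) : Odd (a.val + b.val) := by
    obtain ⟨r, hr⟩ := ht
    rw [Fin.val_sub] at hab
    rcases Nat.lt_or_ge (t - b.val + a.val) t with hlt | hle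
    · rw [Nat.mod_eq_of_lt hlt] at hab
      exact ⟨r - 1 + a.val, by omega⟩
    · rw [Nat.mod_eq_sub_mod hle, Nat.mod_eq_of_lt (by omega)] at hab
      exact ⟨b.val, by omega⟩
  rw [SimpleGraph.cycleGraph_adj'] at h
  rcases h with h | h
  · exact odd_add h
  · exact add_comm i.val j.val ▸ odd_add h

namespace IsUniformDisc

lemma six_le_degree (hU : IsUniformDisc D s t) (hs : 6 ≤ s) (ht : 6 ≤ t) {x : W}
    (hx : IsInteriorVertex D x) : 6 ≤ ((skeleton D).neighborSet x).ncard := by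
  by_cases hst : s = t
  · rwa [(hU.1 hst x hx).2]
  · rcases (hU.2 hst x hx).1 with h | h <;> rwa [h.2]

lemma not_isKVertex_of_adj (hU : IsUniformDisc D s t) (hst : s ≠ t) {x y : W}
    (hx : IsKVertex D s x) (hxy : (skeleton D).Adj x y) : ¬ IsKVertex D s y := fun hy =>
  ((hU.2 hst x hx.1).2.1 hx y hxy).elim (fun h => hst (hy.eq h)) hy.1

/-- Two consecutive neighbours of a `t`-vertex have opposite parities in its cycle of neighbours. -/
lemma exists_isKVertex (hU : IsUniformDisc D s t) (hst : s ≠ t) (ht : Even t) {x y z : W}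
    (hx : IsInteriorVertex D x) (hy : IsInteriorVertex D y) (hz : IsInteriorVertex D z)
    (hxy : (skeleton D).Adj x y) (hxz : (skeleton D).Adj x z) (hyz : (skeleton D).Adj y z) :
    IsKVertex D s x ∨ IsKVertex D s y ∨ IsKVertex D s z := by
  refine or_iff_not_imp_left.2 fun hxs => ?_
  obtain ⟨hdeg, -, halt⟩ := hU.2 hst x hx
  obtain ⟨c, -, hrange, hadj, -, heven⟩ := halt (hdeg.resolve_left hxs)
  obtain ⟨i, rfl⟩ : y ∈ Set.range c := hrange ▸ hxy
  obtain ⟨j, rfl⟩ : z ∈ Set.range c := hrange ▸ hxz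
  have parity := Nat.odd_add.1 (odd_add_of_cycleGraph_adj ht ((hadj i j).1 hyz))
  rcases Nat.even_or_odd i.val with hi | hi
  · have hj : Odd j.val := Nat.not_even_iff_odd.1 fun hj =>
      Nat.not_odd_iff_even.2 hi (parity.2 hj)
    exact .inr ((heven j hj.add_one).resolve_right hz)
  · exact .inl ((heven i hi.add_one).resolve_right hy)

lemma sum_indicator_eq_one (hU : IsUniformDisc D s t) (hst : s ≠ t) (ht : Even t) {τ : Finset W}
    (hτ : τ ∈ triangles D) (hint : ∀ x ∈ τ, IsInteriorVertex D x) :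
    ∑ x ∈ τ, (if IsKVertex D s x then (1 : ℝ) else 0) = 1 := by
  obtain ⟨x, y, z, hxy, hxz, hyz, rfl⟩ := card_eq_three.1 hτ.2
  have axy : (skeleton D).Adj x y := ⟨hxy, mem_faces_of_subset hτ.1 (by simp) (by simp)⟩
  have axz : (skeleton D).Adj x z := ⟨hxz, mem_faces_of_subset hτ.1 (by simp) (by simp)⟩
  have ayz : (skeleton D).Adj y z := ⟨hyz, mem_faces_of_subset hτ.1 (by simp) (by simp)⟩
  rw [sum_insert (by simp [hxy, hxz]), sum_pair hyz]
  rcases hU.exists_isKVertex hst ht (hint x (by simp)) (hint y (by simp)) (hint z (by simp))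
    axy axz ayz with h | h | h
  · simp [h, hU.not_isKVertex_of_adj hst h axy, hU.not_isKVertex_of_adj hst h axz]
  · simp [h, hU.not_isKVertex_of_adj hst h axy.symm, hU.not_isKVertex_of_adj hst h ayz]
  · simp [h, hU.not_isKVertex_of_adj hst h axz.symm, hU.not_isKVertex_of_adj hst h ayz.symm]

theorem exists_isVertexWeight (hU : IsUniformDisc D s t) (ht : s ≠ t → Even t) :
    ∃ w, IsVertexWeight D s t w := by
  by_cases hst : s = t
  · subst hst
    refine ⟨fun _ => 1 / 3, fun _ => by simp, fun x hx => ?_, fun x hx => ?_, fun τ hτ _ => ?_⟩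
    · rw [(hU.1 rfl x hx).2, sub_self, zero_mul, add_zero]
    · rw [(hU.1 rfl x hx).2, mul_comm]
    · rw [sum_const, hτ.2]
      norm_num
  · refine ⟨fun x => if IsKVertex D s x then 1 else 0, fun x => ?_, fun x hx => ?_, fun x _ => ?_,
      fun τ hτ => hU.sum_indicator_eq_one hst (ht hst) hτ⟩ <;>
      by_cases hs : IsKVertex D s x
    · simp [hs]
    · simp [hs]
    · simp [hs, hs.2]
    · simp [hs, ((hU.2 hst x hx).1.resolve_left hs).2]
    · simp [hs, hs.2]
    · simp [hs]

end IsUniformDisc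

/-- The linear recurrences, up to radius `n`, for the lengths `x k` of the spheres about a centre of
weight `a` in an `(s,t)`-uniform disc; `y k` is the total weight of the vertices of the `k`-th
sphere. -/
structure IsSphereSequence (s t a : ℝ) (n : ℕ) (x y : ℕ → ℝ) : Prop where
  x_zero : x 0 = 0
  y_zero : y 0 = 0
  x_one : x 1 = t + (s - t) * a
  y_one : y 1 = t * (1 - a) / 2
  x_rec : ∀ k, k + 1 < n → x (k + 2) = (s - 4) * y (k + 1) + (t - 4) * (x (k + 1) - y (k + 1)) - x k
  y_rec : ∀ k, k + 2 < n → y (k + 2) = (t - 4) / 2 * (x (k + 1) - y (k + 1)) - y k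

variable [Fintype W]

lemma edgeWeight_one : edgeWeight D v 1 k = 2 * sphereLength D v k := by
  rw [edgeWeight, ← card_sphereFinset, mul_comm, ← nsmul_eq_mul, ← sum_const]
  refine sum_congr rfl fun e he => ?_
  simp [(mem_sphereFinset.1 he).2.1]

lemma sum_one_of_mem_triangleFinset {τ : Finset W} (hτ : τ ∈ triangleFinset D) :
    ∑ x ∈ τ, (1 : W → ℝ) x = 3 := by
  simp [(mem_triangleFinset.1 hτ).2]

namespace IsInteriorBall

lemma sphereFinset_zero (h : IsInteriorBall D v n) : sphereFinset D v 0 = ∅ := by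
  refine eq_empty_of_forall_notMem fun e he => ?_
  obtain ⟨x, y, hxy, hx, hy, -⟩ := exists_eq_pair_of_mem_sphereFinset he
  exact h.not_adj_of_dist_eq_zero hx hy hxy

omit [Fintype W] in
lemma sphereLength_one (h : IsInteriorBall D v n) (hn : 0 < n) :
    (sphereLength D v 1 : ℝ) = ((skeleton D).neighborSet v).ncard := by
  have := h.disc.finite
  cases nonempty_fintype W
  have degree_eq := h.center_mul_degree hn (w := 1) fun τ hτ _ => sum_one_of_mem_triangleFinset hτ
  rw [edgeWeight_one, Pi.one_apply] at degree_eq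
  linarith

lemma sum_degree (h : IsInteriorBall D v n) (hk : k + 1 < n) :
    ∑ x ∈ atLevel D v (k + 1) univ, (((skeleton D).neighborSet x).ncard : ℝ) =
      sphereLength D v (k + 2) + sphereLength D v k + 4 * sphereLength D v (k + 1) := by
  have sum_eq := h.sum_mul_degree hk (w := 1) fun τ hτ _ => sum_one_of_mem_triangleFinset hτ
  simp only [edgeWeight_one, Pi.one_apply, one_mul] at sum_eq
  rw [sum_eq]
  ring

lemma card_atLevel_univ (h : IsInteriorBall D v n) (hk : k + 1 < n) :
    (#(atLevel D v (k + 1) univ) : ℝ) = sphereLength D v (k + 1) := by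
  have edgeWeight_eq := h.edgeWeight_eq hk 1
  simp only [edgeWeight_one, Pi.one_apply, sum_const, nsmul_one] at edgeWeight_eq
  linarith

lemma sphereLength_add_two (h : IsInteriorBall D v n) (hk : k + 1 < n)
    (hw : IsVertexWeight D s t w) :
    (sphereLength D v (k + 2) : ℝ) = (s - 4) * (edgeWeight D v w (k + 1) / 2) +
      (t - 4) * (sphereLength D v (k + 1) - edgeWeight D v w (k + 1) / 2) - sphereLength D v k := by
  have sum_eq : ∑ x ∈ atLevel D v (k + 1) univ, (((skeleton D).neighborSet x).ncard : ℝ) =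
      t * sphereLength D v (k + 1) + (s - t) * (edgeWeight D v w (k + 1) / 2) := by
    rw [← h.card_atLevel_univ hk, h.edgeWeight_eq hk, mul_div_cancel_left₀ _ two_ne_zero, mul_sum,
      mul_comm, ← nsmul_eq_mul, ← sum_const, ← sum_add_distrib]
    exact sum_congr rfl fun x hx => hw.degree x (h.interior x ((mem_atLevel.1 hx).2.trans_lt hk))
  linarith [h.sum_degree hk]

lemma sum_eq_one_of_dist_le (h : IsInteriorBall D v n) (hk : k < n) (hw : IsVertexWeight D s t w)
    {τ : Finset W} (hτ : τ ∈ triangleFinset D) (hle : ∀ x ∈ τ, (skeleton D).dist v x ≤ k) :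
    ∑ x ∈ τ, w x = 1 :=
  hw.sum_eq_one τ (mem_triangleFinset.1 hτ) fun x hx => h.interior x ((hle x hx).trans_lt hk)

lemma edgeWeight_add_two (h : IsInteriorBall D v n) (hk : k + 2 < n)
    (hw : IsVertexWeight D s t w) :
    edgeWeight D v w (k + 2) = sphereLength D v (k + 2) + sphereLength D v k -
      edgeWeight D v w k - (s - 4) * (edgeWeight D v w (k + 1) / 2) := by
  have sum_eq : ∑ x ∈ atLevel D v (k + 1) univ, w x * ((skeleton D).neighborSet x).ncard =
      s * (edgeWeight D v w (k + 1) / 2) := by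
    rw [h.edgeWeight_eq (by omega), mul_div_cancel_left₀ _ two_ne_zero, mul_sum]
    exact sum_congr rfl fun x hx =>
      hw.mul_degree x (h.interior x ((mem_atLevel.1 hx).2.trans_lt (by omega)))
  rw [h.sum_mul_degree (by omega) fun τ => h.sum_eq_one_of_dist_le hk hw] at sum_eq
  linarith

theorem isSphereSequence (h : IsInteriorBall D v n) (hn : 2 ≤ n) (hw : IsVertexWeight D s t w) :
    IsSphereSequence s t (w v) n (fun k => sphereLength D v k) fun k => edgeWeight D v w k / 2 := by
  have hv : IsInteriorVertex D v := h.interior v (by rw [SimpleGraph.dist_self]; omega)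
  have x_one : (sphereLength D v 1 : ℝ) = t + (s - t) * w v :=
    (h.sphereLength_one (by omega)).trans (hw.degree v hv)
  have center := h.center_mul_degree (by omega) fun τ => h.sum_eq_one_of_dist_le (k := 1) hn hw
  rw [hw.mul_degree v hv] at center
  exact
    { x_zero := by rw [← card_sphereFinset, h.sphereFinset_zero, card_empty, Nat.cast_zero]
      y_zero := by rw [edgeWeight, h.sphereFinset_zero, sum_empty, zero_div]
      x_one := x_one
      y_one := by linarith
      x_rec := fun k hk => h.sphereLength_add_two hk hw
      y_rec := fun k hk => by
        linarith [h.edgeWeight_add_two hk hw, h.sphereLength_add_two (show k + 1 < n by omega) hw] }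

end IsInteriorBall

end Uniform

open Filter Topology

section LinearRecurrence

variable {f : ℕ → ℝ} {c l p q L : ℝ}

lemma tendsto_zero_of_lyapunov {V : ℕ → ℝ} (hc : 0 < c) (hV : ∀ k, 0 ≤ V k)
    (hVf : ∀ k, V (k + 1) + c * f k ^ 2 ≤ V k) : Tendsto f atTop (𝓝 0) := by
  have telescope (n : ℕ) : V n + c * ∑ k ∈ range n, f k ^ 2 ≤ V 0 := by
    induction n with
    | zero => simp
    | succ n ih =>
      rw [sum_range_succ]
      linarith [hVf n]
  have summable : Summable fun k => f k ^ 2 :=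
    summable_of_sum_range_le (c := V 0 / c) (fun k => sq_nonneg (f k)) fun n => by
      rw [le_div_iff₀' hc]
      linarith [telescope n, hV n]
  simpa [tendsto_zero_iff_abs_tendsto_zero f, Function.comp_def, Real.sqrt_sq_eq_abs] using
    summable.tendsto_atTop_zero.sqrt

theorem tendsto_zero_of_abs_lt (hp : |p| < 1 + q) (hq : q < 1)
    (hf : ∀ k, f (k + 2) = -p * f (k + 1) - q * f k) : Tendsto f atTop (𝓝 0) := by
  have hq' : 0 < 1 + q := (abs_nonneg p).trans_lt hp
  have hg : 0 < (1 + q) ^ 2 - p ^ 2 := sub_pos.2 (sq_lt_sq' (abs_lt.1 hp).1 (abs_lt.1 hp).2)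
  set g := (1 + q) ^ 2 - p ^ 2 with hgdef
  have hd : 0 < (1 - q) * g := mul_pos (sub_pos.2 hq) hg
  -- The quadratic form in `(f (k + 1), f k)` that drops by `(1 - q) g (f (k + 1) ^ 2 + f k ^ 2)`
  -- in every step.
  let V (k : ℕ) : ℝ := 2 * (1 + q) * f (k + 1) ^ 2 + 4 * p * q * (f (k + 1) * f k) +
    ((1 - q) * g + 2 * (1 + q) * q ^ 2) * f k ^ 2
  have V_nonneg (k : ℕ) : 0 ≤ V k := by
    have complete_square : (1 + q) * V k = 2 * ((1 + q) * f (k + 1) + p * q * f k) ^ 2 +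
        ((1 + q) * ((1 - q) * g) + 2 * q ^ 2 * g) * f k ^ 2 := by
      simp only [V, hgdef]
      ring
    refine nonneg_of_mul_nonneg_right (complete_square ▸ ?_) hq'
    positivity
  have V_succ (k : ℕ) : V (k + 1) = V k - (1 - q) * g * (f (k + 1) ^ 2 + f k ^ 2) := by
    simp only [V, hf, hgdef]
    ring
  refine tendsto_zero_of_lyapunov hd V_nonneg fun k => ?_
  linarith [V_succ k, mul_nonneg hd.le (sq_nonneg (f (k + 1)))]

lemma tendsto_div_pow_zero_of_recurrence (hf : ∀ k, f (k + 2) = c * f (k + 1) - f k) (hl : 1 < l)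
    (hc : |c| < l + l⁻¹) : Tendsto (fun n => f n / l ^ n) atTop (𝓝 0) := by
  have hl0 : 0 < l := one_pos.trans hl
  refine tendsto_zero_of_abs_lt (p := -c / l) (q := l⁻¹ ^ 2) ?_ ?_ fun k => ?_
  · rw [abs_div, abs_neg, abs_of_pos hl0, div_lt_iff₀ hl0]
    refine hc.trans_eq ?_
    field_simp
  · exact pow_lt_one₀ (by positivity) (inv_lt_one_of_one_lt₀ hl) two_ne_zero
  · rw [hf]
    field_simp
    ring

lemma tendsto_div_pow_of_recurrence (hf : ∀ k, f (k + 2) = c * f (k + 1) - f k)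
    (hlc : l + l⁻¹ = c) (hl : 1 < l) :
    Tendsto (fun n => f n / l ^ n) atTop (𝓝 ((f 1 - l⁻¹ * f 0) / (l - l⁻¹))) := by
  have hl0 : l ≠ 0 := (one_pos.trans hl).ne'
  have hinv : l⁻¹ < 1 := inv_lt_one_of_one_lt₀ hl
  have hd : l - l⁻¹ ≠ 0 := (sub_pos.2 (hinv.trans hl)).ne'
  have closed_form (n : ℕ) :
      (l - l⁻¹) * f n = (f 1 - l⁻¹ * f 0) * l ^ n + (l * f 0 - f 1) * l⁻¹ ^ n := by
    induction n using Nat.twoStepInduction with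
    | zero => ring
    | one => ring
    | more n ih₀ ih₁ =>
      rw [← hlc] at hf
      linear_combination (l - l⁻¹) * hf n + (l + l⁻¹) * ih₁ - ih₀ +
        ((f 1 - l⁻¹ * f 0) * l ^ n + (l * f 0 - f 1) * l⁻¹ ^ n) * mul_inv_cancel₀ hl0
  have inv_sq_lt : l⁻¹ ^ 2 < 1 := pow_lt_one₀ (by positivity) hinv two_ne_zero
  have lim := (((tendsto_pow_atTop_nhds_zero_of_lt_one (by positivity) inv_sq_lt).const_mul
    (l * f 0 - f 1)).const_add (f 1 - l⁻¹ * f 0)).div_const (l - l⁻¹)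
  rw [mul_zero, add_zero] at lim
  refine lim.congr fun n => ?_
  rw [div_eq_div_iff hd (pow_ne_zero n hl0), mul_comm (f n), closed_form, add_mul,
    mul_assoc _ _ (l ^ n), pow_right_comm, sq, mul_assoc (l⁻¹ ^ n), ← mul_pow, inv_mul_cancel₀ hl0,
    one_pow, mul_one]

lemma tendsto_sum_pow_div_pow (hl : 1 < l) :
    Tendsto (fun n => (∑ k ∈ range n, l ^ k) / l ^ n) atTop (𝓝 (l - 1)⁻¹) := by
  have lim := ((tendsto_pow_atTop_nhds_zero_of_lt_one (inv_nonneg.2 (one_pos.trans hl).le)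
    (inv_lt_one_of_one_lt₀ hl)).const_sub 1).div_const (l - 1)
  rw [sub_zero, one_div] at lim
  refine lim.congr fun n => ?_
  have hn : l ^ n ≠ 0 := pow_ne_zero n (one_pos.trans hl).ne'
  rw [geom_sum_eq hl.ne', div_right_comm, sub_div (l ^ n), div_self hn, inv_pow, one_div (l ^ n)]

lemma tendsto_sum_div_pow (hl : 1 < l) (hf : Tendsto (fun n => f n / l ^ n) atTop (𝓝 L)) :
    Tendsto (fun n => (∑ k ∈ range n, f k) / l ^ n) atTop (𝓝 (L / (l - 1))) := by
  have pow_ne (n : ℕ) : l ^ n ≠ 0 := pow_ne_zero n (one_pos.trans hl).ne'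
  have geom_atTop : Tendsto (fun n => ∑ k ∈ range n, l ^ k) atTop atTop := by
    refine tendsto_atTop_mono (fun n => ?_) tendsto_natCast_atTop_atTop
    simpa using sum_le_sum fun k (_ : k ∈ range n) => one_le_pow₀ hl.le
  have remainder : (fun n => f n - L * l ^ n) =o[atTop] fun n => l ^ n := by
    rw [Asymptotics.isLittleO_iff_tendsto fun n h => absurd h (pow_ne n)]
    simpa [sub_div, mul_div_cancel_right₀ _ (pow_ne _)] using hf.sub_const L
  have sum_remainder :=
    (remainder.sum_range (fun n => by positivity) geom_atTop).tendsto_div_nhds_zero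
  have lim := (sum_remainder.add_const L).mul (tendsto_sum_pow_div_pow hl)
  rw [zero_add, ← div_eq_mul_inv] at lim
  refine lim.congr' ?_
  filter_upwards [geom_atTop.eventually_ne_atTop 0] with n hn
  rw [sum_sub_distrib, ← mul_sum, sub_div, mul_div_cancel_right₀ _ hn, sub_add_cancel,
    div_mul_div_cancel₀ hn]

lemma tendsto_sum_add_succ_div (hl : 1 < l) (hL : L ≠ 0)
    (hf : Tendsto (fun n => f n / l ^ n) atTop (𝓝 L)) :
    Tendsto (fun n => (∑ k ∈ range n, (f k + f (k + 1))) / f n) atTop (𝓝 ((l + 1) / (l - 1))) := by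
  have hl0 : l ≠ 0 := (one_pos.trans hl).ne'
  have f_succ : Tendsto (fun n => f (n + 1) / l ^ n) atTop (𝓝 (L * l)) := by
    refine ((hf.comp (tendsto_add_atTop_nat 1)).mul_const l).congr fun n => ?_
    rw [Function.comp_apply, pow_succ, ← div_div, div_mul_cancel₀ _ hl0]
  have lim := (tendsto_sum_div_pow hl ((hf.add f_succ).congr fun n => (add_div ..).symm)).div hf hL
  rw [show (L + L * l) / (l - 1) / L = (l + 1) / (l - 1) by field_simp; ring] at lim
  exact lim.congr fun n => div_div_div_cancel_right₀ (pow_ne_zero n hl0) ..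

end LinearRecurrence

section Asymptotics

variable {s t a P l q : ℝ} {n : ℕ} {x y : ℕ → ℝ}

lemma exists_one_lt_add_inv_eq (hP : 2 < P) : ∃ l, 1 < l ∧ l + l⁻¹ = P := by
  have root_sq : √(P ^ 2 - 4) ^ 2 = P ^ 2 - 4 := Real.sq_sqrt (by nlinarith)
  have one_lt : 1 < (P + √(P ^ 2 - 4)) / 2 := by linarith [Real.sqrt_nonneg (P ^ 2 - 4)]
  refine ⟨(P + √(P ^ 2 - 4)) / 2, one_lt, ?_⟩
  field_simp
  linear_combination root_sq

lemma sqrt_add_two_div_sub_two (hl : 1 < l) :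
    √((l + l⁻¹ + 2) / (l + l⁻¹ - 2)) = (l + 1) / (l - 1) := by
  have := sub_pos.2 hl
  rw [← Real.sqrt_sq (show 0 ≤ (l + 1) / (l - 1) by positivity), div_pow]
  congr 1
  have sub_eq : l + l⁻¹ - 2 = (l - 1) ^ 2 / l := by field_simp; ring
  have add_eq : l + l⁻¹ + 2 = (l + 1) ^ 2 / l := by field_simp; ring
  rw [sub_eq, add_eq, div_div_div_cancel_right₀ (by positivity)]

/-- The pair `(x, y)` of sequences that satisfies the recurrences of `IsSphereSequence` at every
radius. -/
def sphereSolution (s t a : ℝ) : ℕ → ℝ × ℝ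
  | 0 => (0, 0)
  | 1 => (t + (s - t) * a, t * (1 - a) / 2)
  | k + 2 =>
    let p := sphereSolution s t a (k + 1)
    ((s - 4) * p.2 + (t - 4) * (p.1 - p.2) - (sphereSolution s t a k).1,
      (t - 4) / 2 * (p.1 - p.2) - (sphereSolution s t a k).2)

lemma IsSphereSequence.eq_sphereSolution (h : IsSphereSequence s t a n x y) (k : ℕ) :
    (k ≤ n → x k = (sphereSolution s t a k).1) ∧ (k < n → y k = (sphereSolution s t a k).2) := by
  induction k using Nat.twoStepInduction with
  | zero => exact ⟨fun _ => h.x_zero, fun _ => h.y_zero⟩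
  | one => exact ⟨fun _ => h.x_one, fun _ => h.y_one⟩
  | more k ih₀ ih₁ =>
    refine ⟨fun hk => ?_, fun hk => ?_⟩
    · rw [h.x_rec k hk, ih₁.1 (by omega), ih₁.2 hk, ih₀.1 (by omega), sphereSolution]
    · rw [h.y_rec k hk, ih₁.1 (by omega), ih₁.2 (by omega), ih₀.2 (by omega), sphereSolution]

/-- The linear form `(s - 4) y + q (x - y)` in `(x, y)`, evaluated along the sphere solution. For
the two roots `q` of `2 q ^ 2 = (t - 4) q + (s - 4) (t - 4)` it diagonalizes the recurrences. -/
def sphereForm (s t a q : ℝ) (k : ℕ) : ℝ :=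
  (s - 4) * (sphereSolution s t a k).2 +
    q * ((sphereSolution s t a k).1 - (sphereSolution s t a k).2)

lemma sphereForm_add_two (hq : 2 * q ^ 2 = (t - 4) * q + (s - 4) * (t - 4)) (k : ℕ) :
    sphereForm s t a q (k + 2) = q * sphereForm s t a q (k + 1) - sphereForm s t a q k := by
  simp only [sphereForm, sphereSolution]
  linear_combination
    (-((sphereSolution s t a (k + 1)).1 - (sphereSolution s t a (k + 1)).2) / 2) * hq

lemma sphereForm_one_pos (hs : 4 < s) (ht : 4 < t) (hP : 0 < P) (ha : 0 ≤ a) (ha' : a ≤ 1) :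
    0 < sphereForm s t a P 1 := by
  have y_nonneg : 0 ≤ t * (1 - a) / 2 := by
    have := sub_nonneg.2 ha'
    positivity
  have sub_pos : 0 < t + (s - t) * a - t * (1 - a) / 2 := by nlinarith
  exact add_pos_of_nonneg_of_pos (mul_nonneg (by linarith) y_nonneg) (mul_pos hP sub_pos)

lemma half_lt_root (hs : 4 < s) (ht : 4 < t) (hP0 : 0 < P)
    (hP : 2 * P ^ 2 = (t - 4) * P + (s - 4) * (t - 4)) : (t - 4) / 2 < P := by
  have : 0 < P * (P - (t - 4) / 2) := by nlinarith [mul_pos (sub_pos.2 hs) (sub_pos.2 ht)]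
  exact sub_pos.1 (pos_of_mul_pos_right this hP0.le)

lemma exists_tendsto_sphereSolution_div_pow (hs : 4 < s) (ht : 4 < t)
    (hP : 2 * P ^ 2 = (t - 4) * P + (s - 4) * (t - 4)) (hl : 1 < l) (hlP : l + l⁻¹ = P)
    (ha : 0 ≤ a) (ha' : a ≤ 1) :
    ∃ L ≠ 0, Tendsto (fun n => (sphereSolution s t a n).1 / l ^ n) atTop (𝓝 L) := by
  have hP0 : 0 < P := hlP ▸ by positivity
  set Q := (t - 4) / 2 - P with hQ_def
  have hQ : 2 * Q ^ 2 = (t - 4) * Q + (s - 4) * (t - 4) := by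
    rw [hQ_def]
    linear_combination hP
  have Q_neg : Q < 0 := sub_neg.2 (half_lt_root hs ht hP0 hP)
  have abs_Q_lt : |Q| < l + l⁻¹ := by
    rw [abs_of_neg Q_neg, hlP]
    linarith
  have lim_P := tendsto_div_pow_of_recurrence (sphereForm_add_two (a := a) hP) hlP hl
  have lim_Q := tendsto_div_pow_zero_of_recurrence (sphereForm_add_two (a := a) hQ) hl abs_Q_lt
  have hs0 : 0 < s - 4 := sub_pos.2 hs
  have hl0 : 0 < l - l⁻¹ := sub_pos.2 ((inv_lt_one_of_one_lt₀ hl).trans hl)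
  have hPQ : 0 < P - Q := sub_pos.2 (Q_neg.trans hP0)
  have hsQ : 0 < s - 4 - Q := sub_pos.2 (Q_neg.trans hs0)
  have form_zero : sphereForm s t a P 0 = 0 := by simp [sphereForm, sphereSolution]
  have form_one : 0 < sphereForm s t a P 1 := sphereForm_one_pos hs ht hP0 ha ha'
  rw [form_zero, mul_zero, sub_zero] at lim_P
  refine ⟨_, ?_, (((lim_P.const_mul (s - 4 - Q)).sub (lim_Q.const_mul (s - 4 - P))).div_const
    ((s - 4) * (P - Q))).congr fun n => ?_⟩
  · rw [mul_zero, sub_zero]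
    positivity
  · simp only [sphereForm]
    field_simp
    ring

theorem tendsto_sphereSolution (hs : 4 < s) (ht : 4 < t)
    (hP : 2 * P ^ 2 = (t - 4) * P + (s - 4) * (t - 4)) (hP2 : 2 < P) (ha : 0 ≤ a) (ha' : a ≤ 1) :
    Tendsto (fun n =>
      (∑ k ∈ range n, ((sphereSolution s t a k).1 + (sphereSolution s t a (k + 1)).1)) /
        (sphereSolution s t a n).1) atTop (𝓝 √((P + 2) / (P - 2))) := by
  obtain ⟨l, hl, rfl⟩ := exists_one_lt_add_inv_eq hP2
  obtain ⟨L, hL, lim⟩ := exists_tendsto_sphereSolution_div_pow hs ht hP hl rfl ha ha'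
  rw [sqrt_add_two_div_sub_two hl]
  exact tendsto_sum_add_succ_div hl hL lim

end Asymptotics

section SphereRatio

variable {W : Type*} {D : AbstractSimplicialComplex W} {v : W} {w : W → ℝ} {n s t : ℕ} {P : ℝ}

lemma IsInteriorBall.sphereArea_div_sphereLength (h : IsInteriorBall D v n) (hn : 2 ≤ n)
    (hw : IsVertexWeight D s t w) :
    (sphereArea D v n : ℝ) / sphereLength D v n =
      (∑ k ∈ range n,
        ((sphereSolution s t (w v) k).1 + (sphereSolution s t (w v) (k + 1)).1)) /
          (sphereSolution s t (w v) n).1 := by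
  have := h.disc.finite
  cases nonempty_fintype W
  have length_eq (k : ℕ) (hk : k ≤ n) :
      (sphereLength D v k : ℝ) = (sphereSolution s t (w v) k).1 :=
    ((h.isSphereSequence hn hw).eq_sphereSolution k).1 hk
  rw [h.sphereArea_eq, length_eq n le_rfl]
  push_cast
  congr 1
  refine sum_congr rfl fun k hk => ?_
  have hk' := mem_range.1 hk
  rw [length_eq k hk'.le, length_eq (k + 1) hk']

/-- The analogue of `SphereRatioTendsto` for all discs that satisfy the condition which
`(s,t)`-uniformity puts on minimal filling diagrams, whether or not they fill a loop. -/
def DiscSphereRatioTendsto (s t : ℕ) (L : ℝ) : Prop :=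
  ∀ ε : ℝ, 0 < ε → ∃ N : ℕ, ∀ n : ℕ, N ≤ n →
    ∀ (W : Type u) (D : AbstractSimplicialComplex W), IsDisc D → IsUniformDisc D s t →
    ∀ v : W, (∀ w : W, (skeleton D).dist v w < n → IsInteriorVertex D w) →
      |(sphereArea D v n : ℝ) / (sphereLength D v n : ℝ) - L| < ε

theorem discSphereRatioTendsto_sqrt (hs : 6 ≤ s) (ht : 6 ≤ t) (ht_even : s ≠ t → Even t)
    (hP : 2 * P ^ 2 = (t - 4) * P + (s - 4) * (t - 4)) (hP2 : 2 < P) :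
    DiscSphereRatioTendsto.{u} s t √((P + 2) / (P - 2)) := by
  intro ε hε
  have solution_near : ∀ᶠ n in atTop, ∀ a ∈ ({0, 1 / 3, 1} : Finset ℝ),
      |(∑ k ∈ range n, ((sphereSolution s t a k).1 + (sphereSolution s t a (k + 1)).1)) /
        (sphereSolution s t a n).1 - √((P + 2) / (P - 2))| < ε := by
    rw [eventually_all_finset]
    intro a ha
    have mem_Icc : 0 ≤ a ∧ a ≤ 1 := by
      simp only [mem_insert, mem_singleton] at ha
      rcases ha with rfl | rfl | rfl <;> norm_num
    have hs' : (4 : ℝ) < s := by exact_mod_cast (by omega : 4 < s)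
    have ht' : (4 : ℝ) < t := by exact_mod_cast (by omega : 4 < t)
    simpa [Real.dist_eq] using Metric.tendsto_nhds.1
      (tendsto_sphereSolution hs' ht' hP hP2 mem_Icc.1 mem_Icc.2) ε hε
  obtain ⟨N, hN⟩ := eventually_atTop.1 (solution_near.and (eventually_ge_atTop 2))
  refine ⟨N, fun n hn W D hD hU v hv => ?_⟩
  obtain ⟨near, two_le⟩ := hN n hn
  obtain ⟨w, hw⟩ := hU.exists_isVertexWeight ht_even
  have ball : IsInteriorBall D v n := ⟨hD, fun x hx => hU.six_le_degree hs ht hx, hv⟩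
  rw [ball.sphereArea_div_sphereLength two_le hw]
  exact near (w v) (hw.mem v)

lemma DiscSphereRatioTendsto.sphereRatioTendsto {L : ℝ} (h : DiscSphereRatioTendsto.{0} s t L) :
    SphereRatioTendsto.{u} s t L := by
  intro ε hε
  obtain ⟨N, hN⟩ := h ε hε
  exact ⟨N, fun n hn _ _ hX γ hγ W D f hf v _ hv =>
    hN n hn W D hf.filling.disc (hX.uniform γ hγ W D f hf) v hv⟩

section Constant

variable {S T : ℝ}

lemma two_mul_root_sq (hS : 0 ≤ S) (hT : 0 ≤ T) (hP : P = (T + √(T ^ 2 + 8 * S * T)) / 4) :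
    2 * P ^ 2 = T * P + S * T := by
  have : √(T ^ 2 + 8 * S * T) ^ 2 = T ^ 2 + 8 * S * T := Real.sq_sqrt (by positivity)
  rw [hP]
  linear_combination this / 8

lemma two_lt_root (hS : 2 ≤ S) (hT : 2 ≤ T) (hST : 4 < S + T)
    (hP : P = (T + √(T ^ 2 + 8 * S * T)) / 4) : 2 < P := by
  have : 8 - T < √(T ^ 2 + 8 * S * T) := Real.lt_sqrt_of_sq_lt (by nlinarith)
  linarith

lemma add_eight_div_sub_eight_eq_root (hP : P = (T + √(T ^ 2 + 8 * S * T)) / 4) :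
    (T + 8 + √(T ^ 2 + 8 * S * T)) / (T - 8 + √(T ^ 2 + 8 * S * T)) = (P + 2) / (P - 2) := by
  rw [show T + 8 + √(T ^ 2 + 8 * S * T) = 4 * (P + 2) by rw [hP]; ring,
    show T - 8 + √(T ^ 2 + 8 * S * T) = 4 * (P - 2) by rw [hP]; ring,
    mul_div_mul_left _ _ four_ne_zero]

end Constant

end SphereRatio

end SimplicialDisc

end

theorem theorem3p3_general (s t : ℕ) (hs : 6 ≤ s) (ht : 6 ≤ t) (ht_even : s ≠ t → Even t)
    (hst : ¬ (s = 6 ∧ t = 6)) (S T P : ℝ) (hS : S = (s : ℝ) - 4) (hT : T = (t : ℝ) - 4)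
    (hP : P = (T + √(T ^ 2 + 8 * S * T)) / 4) :
    SimplicialDisc.DiscSphereRatioTendsto.{u} s t
      √((T + 8 + √(T ^ 2 + 8 * S * T)) / (T - 8 + √(T ^ 2 + 8 * S * T))) ∧
    SimplicialDisc.DiscSphereRatioTendsto.{u} s t √((P + 2) / (P - 2)) := by
  have hs' : (6 : ℝ) ≤ s := by exact_mod_cast hs
  have ht' : (6 : ℝ) ≤ t := by exact_mod_cast ht
  have hst' : (12 : ℝ) < s + t := by exact_mod_cast (by omega : 12 < s + t)
  have quadratic := SimplicialDisc.two_mul_root_sq (by linarith) (by linarith) hP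
  have two_lt := SimplicialDisc.two_lt_root (by linarith) (by linarith) (by linarith) hP
  rw [SimplicialDisc.add_eight_div_sub_eight_eq_root hP, and_self]
  rw [hS, hT] at quadratic
  exact SimplicialDisc.discSphereRatioTendsto_sqrt hs ht ht_even quadratic two_lt

theorem theorem3p3 (s t : ℕ) (hs : 6 ≤ s) (ht : 6 ≤ t) (ht_even : Even t)
    (hst : ¬ (s = 6 ∧ t = 6)) (S T P : ℝ) (hS : S = (s : ℝ) - 4) (hT : T = (t : ℝ) - 4)
    (hP : P = (T + √(T ^ 2 + 8 * S * T)) / 4) :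
    SimplicialDisc.SphereRatioTendsto.{u} s t
      (√((T + 8 + √(T ^ 2 + 8 * S * T)) / (T - 8 + √(T ^ 2 + 8 * S * T)))) ∧
    SimplicialDisc.SphereRatioTendsto.{u} s t (√((P + 2) / (P - 2))) :=
  (theorem3p3_general s t hs ht (fun _ => ht_even) hst S T P hS hT hP).imp
    SimplicialDisc.DiscSphereRatioTendsto.sphereRatioTendsto
    SimplicialDisc.DiscSphereRatioTendsto.sphereRatioTendsto
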